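/- Let $S$ be a finite nonempty set of states and $Y$ a set of prizes. A lottery is a finitely supported probability on $Y$; $\Delta(Y)$ is the set of lotteries. An act is a map $S\to\Delta(Y)$; mixtures of acts are taken statewise, and $l^*$ is the constant act with value $l$. A menu is the convex hull of a nonempty finite set of acts. A family of menu-dependent preferences assigns to every menu $M$ a binary relation $\succeq_M$ on $M$; write $f\succ_M g$ for $f\succeq_M g$ and not $g\succeq_M f$, write $f\sim_M g$ for $f\succeq_M g$ and $g\succeq_M f$, and for lotteries write $k\succeq l$ for $k^*\succeq_{\mathrm{conv}\{k^*,l^*\}}l^*$. Consider the following axioms, for all menus $M,M'$ and all $p\in(0,1)$, where a statement $f\succeq_M g$ is made only for $f,g\in M$. 1. Monotonicity: if $f(s)\succeq g(s)$ for all $s\in S$, then $f\succeq_M g$. 2. Completeness: $f\succeq_M g$ or $g\succeq_M f$. 3. Nontriviality: $f\succ_M g$ for some menu $M$ and some $f,g\in M$. 4. Mixture Continuity: if $f\succ_M g\succ_M h$, then there are $q,r\in(0,1)$ with $qf+(1-q)h\succ_M g\succ_M rf+(1-r)h$. 5. Transitivity: if $f\succeq_M g\succeq_M h$, then $f\succeq_M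 h$. 6. Menu independence for constant acts: if $k^*,l^*\in M\cap M'$, then $k^*\succeq_M l^*$ iff $k^*\succeq_{M'}l^*$. 7. Independence: for every act $h$ (in $M$ or not), $f\succeq_M g$ iff $pf+(1-p)h\succeq_{pM+(1-p)h}pg+(1-p)h$. 8. Symmetry: if $E,F\subseteq S$ are nonempty and disjoint and all acts in $M$ are constant on $E$ and constant on $F$, let $f'$ be obtained from $f\in M$ by exchanging its values on $E$ and $F$, and let $M'=\{f':f\in M\}$; then $f\succeq_M g$ iff $f'\succeq_{M'}g'$. 9. Ambiguity Aversion: if $f\sim_M g$, then $pf+(1-p)g\succeq_M g$. 10. Independence of Never Strictly Worst Alternatives (INWA): if an act $a$ is such that for every $s\in S$ there is $a'\in M$ with $a(s)\succeq a'(s)$, then for $f,g\in M$, $f\succeq_M g$ iff $f\succeq_{\mathrm{conv}(M\cup\{a\})}g$. For $U:Y\to\mathbb R$ put $u(l)=\sum_{y}l(y)U(y)$ and $u(f,s)=u(f(s))$. The maximin safety family of $U$ is given, for $f,g\in M$, by $$f\succeq_M g\iff \min_{s\in S}\Bigl(u(f,s)-\min_{h\in M}u(h,s)\Bigr)\ \ge\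 \min_{s\in S}\Bigl(u(g,s)-\min_{h\in M}u(h,s)\Bigr).$$ Theorem 1. (i) For every nonconstant $U:Y\to\mathbb R$, the maximin safety family of $U$ satisfies Axioms 1–10. (ii) Conversely, if $|S|\neq 2$, then every family of menu-dependent preferences that satisfies Axioms 1–10 is the maximin safety family of some nonconstant $U:Y\to\mathbb R$. (iii) $U$ is unique up to positive affine transformation: if a family satisfies Axioms 1–10 and is the maximin safety family of $U$, then it is the maximin safety family of $U':Y\to\mathbb R$ if and only if there are real numbers $a>0$ and $b$ with $U'=aU+b$. -/

import Mathlib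

namespace MaximinSafety

/-- The lotteries over a set `Y` of prizes: finitely supported probabilities on `Y`. -/
def lotteries (Y : Type*) : Set (Y →₀ ℝ) :=
  {l | (∀ y, 0 ≤ l y) ∧ l.sum (fun _ p => p) = 1}

/-- The acts: maps from states to lotteries. They live in the vector space `S → Y →₀ ℝ`, whose
pointwise operations give the statewise mixtures of acts. -/
def acts (S Y : Type*) : Set (S → Y →₀ ℝ) :=
  {f | ∀ s, f s ∈ lotteries Y}

/-- The constant act that yields the lottery `l` in every state. -/
def constAct (S : Type*) {Y : Type*} (l : Y →₀ ℝ) : S → Y →₀ ℝ := fun _ => l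

/-- The mixture `p f + (1 - p) g`. -/
noncomputable def mix {S Y : Type*} (p : ℝ) (f g : S → Y →₀ ℝ) : S → Y →₀ ℝ :=
  p • f + (1 - p) • g

/-- A menu is the convex hull of a nonempty finite set of acts. -/
def IsMenu {S Y : Type*} (M : Set (S → Y →₀ ℝ)) : Prop :=
  ∃ F : Set (S → Y →₀ ℝ), F.Finite ∧ F.Nonempty ∧ F ⊆ acts S Y ∧ M = convexHull ℝ F

/-- A family of menu-dependent preferences; `R M f g` reads `f ⪰_M g`. Only its values at menus
`M` and at acts `f, g ∈ M` are ever used. -/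
abbrev PrefFamily (S Y : Type*) : Type _ :=
  Set (S → Y →₀ ℝ) → (S → Y →₀ ℝ) → (S → Y →₀ ℝ) → Prop

/-- Strict preference `f ≻_M g`. -/
def Strict {S Y : Type*} (R : PrefFamily S Y) (M : Set (S → Y →₀ ℝ)) (f g : S → Y →₀ ℝ) : Prop :=
  R M f g ∧ ¬ R M g f

/-- Indifference `f ∼_M g`. -/
def Indiff {S Y : Type*} (R : PrefFamily S Y) (M : Set (S → Y →₀ ℝ)) (f g : S → Y →₀ ℝ) : Prop :=
  R M f g ∧ R M g f

/-- The preference between the lotteries `k` and `l`: their constant acts are compared in the menu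
that these two acts generate. -/
def LotteryPref {S Y : Type*} (R : PrefFamily S Y) (k l : Y →₀ ℝ) : Prop :=
  R (convexHull ℝ {constAct S k, constAct S l}) (constAct S k) (constAct S l)

/-! ### The axioms -/

def Monotonicity {S Y : Type*} (R : PrefFamily S Y) : Prop :=
  ∀ M, IsMenu M → ∀ f ∈ M, ∀ g ∈ M, (∀ s, LotteryPref R (f s) (g s)) → R M f g

def Completeness {S Y : Type*} (R : PrefFamily S Y) : Prop :=
  ∀ M, IsMenu M → ∀ f ∈ M, ∀ g ∈ M, R M f g ∨ R M g f

def Nontriviality {S Y : Type*} (R : PrefFamily S Y) : Prop :=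
  ∃ M, IsMenu M ∧ ∃ f ∈ M, ∃ g ∈ M, Strict R M f g

def MixtureContinuity {S Y : Type*} (R : PrefFamily S Y) : Prop :=
  ∀ M, IsMenu M → ∀ f ∈ M, ∀ g ∈ M, ∀ h ∈ M, Strict R M f g → Strict R M g h →
    ∃ q ∈ Set.Ioo (0 : ℝ) 1, ∃ r ∈ Set.Ioo (0 : ℝ) 1,
      Strict R M (mix q f h) g ∧ Strict R M g (mix r f h)

def Transitivity {S Y : Type*} (R : PrefFamily S Y) : Prop :=
  ∀ M, IsMenu M → ∀ f ∈ M, ∀ g ∈ M, ∀ h ∈ M, R M f g → R M g h → R M f h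

def MenuIndependenceConst {S Y : Type*} (R : PrefFamily S Y) : Prop :=
  ∀ M M' : Set (S → Y →₀ ℝ), IsMenu M → IsMenu M' →
    ∀ k ∈ lotteries Y, ∀ l ∈ lotteries Y,
      constAct S k ∈ M → constAct S l ∈ M → constAct S k ∈ M' → constAct S l ∈ M' →
        (R M (constAct S k) (constAct S l) ↔ R M' (constAct S k) (constAct S l))

/-- The third act `h` need not belong to `M`; the mixtures are compared in `p M + (1 - p) h`. -/
def Independence {S Y : Type*} (R : PrefFamily S Y) : Prop :=
  ∀ M, IsMenu M → ∀ f ∈ M, ∀ g ∈ M, ∀ h ∈ acts S Y, ∀ p ∈ Set.Ioo (0 : ℝ) 1,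
    (R M f g ↔ R ((fun k => mix p k h) '' M) (mix p f h) (mix p g h))

/-- `f` is constant on the event `E`. -/
def ConstantOn {S Y : Type*} (E : Set S) (f : S → Y →₀ ℝ) : Prop :=
  ∀ s ∈ E, ∀ t ∈ E, f s = f t

open Classical in
/-- The act `f'` that takes on `F` the value of `f` at `e ∈ E`, takes on `E` the value of `f` at
`e' ∈ F`, and agrees with `f` elsewhere. -/
noncomputable def swapEvents {S Y : Type*} (E F : Set S) (e e' : S) (f : S → Y →₀ ℝ) :
    S → Y →₀ ℝ :=
  fun s => if s ∈ F then f e else if s ∈ E then f e' else f s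

def Symmetry {S Y : Type*} (R : PrefFamily S Y) : Prop :=
  ∀ M, IsMenu M → ∀ E F : Set S, Disjoint E F → ∀ e ∈ E, ∀ e' ∈ F,
    (∀ f ∈ M, ConstantOn E f ∧ ConstantOn F f) →
      ∀ f ∈ M, ∀ g ∈ M,
        (R M f g ↔
          R (swapEvents E F e e' '' M) (swapEvents E F e e' f) (swapEvents E F e e' g))

def AmbiguityAversion {S Y : Type*} (R : PrefFamily S Y) : Prop :=
  ∀ M, IsMenu M → ∀ f ∈ M, ∀ g ∈ M, ∀ p ∈ Set.Ioo (0 : ℝ) 1,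
    Indiff R M f g → R M (mix p f g) g

def NeverStrictlyWorst {S Y : Type*} (R : PrefFamily S Y) (M : Set (S → Y →₀ ℝ))
    (a : S → Y →₀ ℝ) : Prop :=
  ∀ s, ∃ a' ∈ M, LotteryPref R (a s) (a' s)

/-- Independence of never strictly worst alternatives. Adding the act `a` to the menu `M` gives
the menu generated by `M ∪ {a}`. -/
def INWA {S Y : Type*} (R : PrefFamily S Y) : Prop :=
  ∀ M, IsMenu M → ∀ a ∈ acts S Y, NeverStrictlyWorst R M a →
    ∀ f ∈ M, ∀ g ∈ M, (R M f g ↔ R (convexHull ℝ (M ∪ {a})) f g)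

/-- The ten axioms together. -/
structure SafetyAxioms {S Y : Type*} (R : PrefFamily S Y) : Prop where
  monotonicity : Monotonicity R
  completeness : Completeness R
  nontriviality : Nontriviality R
  mixtureContinuity : MixtureContinuity R
  transitivity : Transitivity R
  menuIndependenceConst : MenuIndependenceConst R
  independence : Independence R
  symmetry : Symmetry R
  ambiguityAversion : AmbiguityAversion R
  inwa : INWA R

/-! ### Maximin safety -/

/-- The expected utility of a lottery. -/
noncomputable def expUtility {Y : Type*} (U : Y → ℝ) (l : Y →₀ ℝ) : ℝ :=
  l.sum (fun y p => p * U y)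

/-- The worst utility `min_{h ∈ M} u(h, s)` that a menu offers in state `s`. -/
noncomputable def worstUtility {S Y : Type*} (U : Y → ℝ) (M : Set (S → Y →₀ ℝ)) (s : S) : ℝ :=
  sInf ((fun h => expUtility U (h s)) '' M)

/-- The infimum in `worstUtility` is a minimum for every menu. -/
theorem isLeast_worstUtility {S Y : Type*} (U : Y → ℝ) {M : Set (S → Y →₀ ℝ)} (hM : IsMenu M)
    (s : S) : IsLeast ((fun h => expUtility U (h s)) '' M) (worstUtility U M s) := by
  obtain ⟨F, hF, hne, -, rfl⟩ := hM
  let L : (S → Y →₀ ℝ) →ₗ[ℝ] ℝ := (Finsupp.linearCombination ℝ U).comp (LinearMap.proj s)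
  have hL : (fun h : S → Y →₀ ℝ => expUtility U (h s)) = L := by
    funext h
    simp [L, expUtility, Finsupp.linearCombination_apply]
  have hc : IsCompact ((fun h => expUtility U (h s)) '' convexHull ℝ F) := by
    rw [hL, LinearMap.image_convexHull]
    exact (hF.image _).isCompact_convexHull ℝ
  exact hc.isLeast_sInf (hne.convexHull.image _)

/-- The safety `min_s (u(f, s) - min_{h ∈ M} u(h, s))` of an act `f` in the menu `M`. -/
noncomputable def safety {S Y : Type*} (U : Y → ℝ) (M : Set (S → Y →₀ ℝ)) (f : S → Y →₀ ℝ) : ℝ :=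
  ⨅ s, (expUtility U (f s) - worstUtility U M s)

/-- The family of maximin safety preferences determined by the utility `U` on prizes. -/
def safetyPref (S : Type*) {Y : Type*} (U : Y → ℝ) : PrefFamily S Y :=
  fun M f g => safety U M g ≤ safety U M f

/-- The family `R` is the maximin safety family of `U`. -/
def IsSafetyFamily {S Y : Type*} (R : PrefFamily S Y) (U : Y → ℝ) : Prop :=
  ∀ M, IsMenu M → ∀ f ∈ M, ∀ g ∈ M, (R M f g ↔ safetyPref S U M f g)

/-- Some two prizes have different utilities. -/
def Nonconstant {Y : Type*} (U : Y → ℝ) : Prop := ∃ y₁ y₂, U y₁ ≠ U y₂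

end MaximinSafety

/-!
Soundness is a direct verification: safety is concave, is multiplied by `p` when a menu is mixed
with a fixed act with weight `p`, and depends on the menu only through its worst utilities.

For the representation, the preference between lotteries satisfies the von Neumann–Morgenstern
axioms, which gives `U` (`MixtureOrder.exists_expUtility`): the differences `x - y` with `x` weakly
preferred to `y` generate a cone, and each difference of lotteries is, up to indifference, a
multiple of a fixed strictly positive one.

Call a menu flat if its worst utility is the same in all states and is that of a constant act in
the menu, its floor. By INWA flat menus with the same floor rank their common acts alike
(`IsFlat.pref_iff_pref`). Let `k` be a lottery, `b` a better one, and compare the acts that yield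
`b` in some states and `k` in the others. Symmetry says that it does not matter which state carries
the odd value, and also that "`b` except at `s`" is as good as "`b` only at `s`". With at least
three states, "`b` only at `t`" and "`b` only at `r`" are indifferent, so by ambiguity aversion
their even mixture is at least as good as either; and it is dominated by "`b / 2 + k / 2` except at
`s`". Hence `b` may be moved halfway to `k` without loss (`flatPref_halve`), and in the limit
"`b` except at `s`" is no better than `k`. So in flat menus an act is as good as its worst value
(`flatPref_const_worst`), which is maximin safety there.

An arbitrary menu becomes flat after adding the act `a` of its worst lotteries, by INWA, and mixing
with an act whose value at `s` is the average of `a` over the other states, by independence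
(`SafetyAxioms.isSafetyFamily`). With a single state all acts are constant.

Uniqueness holds because two expected utilities that order the lotteries alike have, as linear
functionals on differences of lotteries, the same kernel (`exists_affine_of_same_order`).
-/

namespace MaximinSafety

open Set

/-! ### Expected utility on a convex set -/

section MixtureSpace

variable {E : Type*} [AddCommGroup E] [Module ℝ E]

/-- A von Neumann–Morgenstern preference `r` on a convex set `C`: a complete transitive relation
that satisfies independence and mixture continuity. -/
structure MixtureOrder (C : Set E) (r : E → E → Prop) : Prop where
  convex : Convex ℝ C
  total : ∀ x ∈ C, ∀ y ∈ C, r x y ∨ r y x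
  trans : ∀ x ∈ C, ∀ y ∈ C, ∀ z ∈ C, r x y → r y z → r x z
  indep : ∀ x ∈ C, ∀ y ∈ C, ∀ z ∈ C, ∀ p ∈ Ioo (0 : ℝ) 1,
    (r x y ↔ r (p • x + (1 - p) • z) (p • y + (1 - p) • z))
  cont : ∀ x ∈ C, ∀ y ∈ C, ∀ z ∈ C, r x y → ¬ r y x → r y z → ¬ r z y →
    ∃ q ∈ Ioo (0 : ℝ) 1, ∃ p ∈ Ioo (0 : ℝ) 1,
      ¬ r y (q • x + (1 - q) • z) ∧ ¬ r (p • x + (1 - p) • z) y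

/-- The cone generated by the differences `x - y` with `x` weakly preferred to `y`. -/
def prefCone (C : Set E) (r : E → E → Prop) : Set E :=
  {v | ∃ t : ℝ, 0 < t ∧ ∃ x ∈ C, ∃ y ∈ C, r x y ∧ v = t • (x - y)}

/-- The subspace of all multiples of differences of elements of `C`. -/
def diffSpace {C : Set E} (hC : Convex ℝ C) (hne : C.Nonempty) : Submodule ℝ E where
  carrier := prefCone C fun _ _ => True
  zero_mem' := by
    obtain ⟨x, hx⟩ := hne
    exact ⟨1, one_pos, x, hx, x, hx, trivial, by simp⟩
  add_mem' := by
    rintro _ _ ⟨t, ht, x, hx, y, hy, -, rfl⟩ ⟨t', ht', x', hx', y', hy', -, rfl⟩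
    have h0 : t + t' ≠ 0 := by positivity
    refine ⟨t + t', by positivity, (t / (t + t')) • x + (t' / (t + t')) • x', ?_,
      (t / (t + t')) • y + (t' / (t + t')) • y', ?_, trivial, ?_⟩
    · exact hC hx hx' (by positivity) (by positivity) (by field_simp)
    · exact hC hy hy' (by positivity) (by positivity) (by field_simp)
    · match_scalars <;> field_simp
  smul_mem' := by
    rintro c _ ⟨t, ht, x, hx, y, hy, -, rfl⟩
    rcases lt_trichotomy c 0 with h | rfl | h
    · exact ⟨-c * t, by nlinarith, y, hy, x, hx, trivial, by module⟩
    · exact ⟨1, one_pos, x, hx, x, hx, trivial, by simp⟩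
    · exact ⟨c * t, by positivity, x, hx, y, hy, trivial, by module⟩

theorem sub_mem_diffSpace {C : Set E} (hC : Convex ℝ C) (hne : C.Nonempty) {x y : E}
    (hx : x ∈ C) (hy : y ∈ C) : x - y ∈ diffSpace hC hne :=
  ⟨1, one_pos, x, hx, y, hy, trivial, by simp⟩

namespace MixtureOrder

variable {C : Set E} {r : E → E → Prop} (H : MixtureOrder C r)
include H

theorem mix_mem {x y : E} (hx : x ∈ C) (hy : y ∈ C) {p : ℝ} (hp : p ∈ Ioo (0 : ℝ) 1) :
    p • x + (1 - p) • y ∈ C :=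
  H.convex hx hy hp.1.le (by linarith [hp.2]) (by ring)

theorem refl {x : E} (hx : x ∈ C) : r x x := (H.total x hx x hx).elim id id

theorem cone_add {v w : E} (hv : v ∈ prefCone C r) (hw : w ∈ prefCone C r) :
    v + w ∈ prefCone C r := by
  obtain ⟨t, ht, x, hx, y, hy, hxy, rfl⟩ := hv
  obtain ⟨t', ht', x', hx', y', hy', hxy', rfl⟩ := hw
  have h0 : t + t' ≠ 0 := by positivity
  have hp : t / (t + t') ∈ Ioo (0 : ℝ) 1 :=
    ⟨by positivity, (div_lt_one (by positivity)).2 (by linarith)⟩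
  have hp' : 1 - t / (t + t') ∈ Ioo (0 : ℝ) 1 := ⟨by linarith [hp.2], by linarith [hp.1]⟩
  have h1 := (H.indep x hx y hy x' hx' _ hp).1 hxy
  have h2 := (H.indep x' hx' y' hy' y hy _ hp').1 hxy'
  rw [sub_sub_cancel, add_comm, add_comm (_ • y')] at h2
  refine ⟨t + t', by positivity, _, H.mix_mem hx hx' hp, _, H.mix_mem hy hy' hp,
    H.trans _ (H.mix_mem hx hx' hp) _ (H.mix_mem hy hx' hp) _ (H.mix_mem hy hy' hp) h1 h2, ?_⟩
  match_scalars <;> field_simp <;> ring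

omit H in
theorem cone_smul {v : E} (hv : v ∈ prefCone C r) {c : ℝ} (hc : 0 < c) :
    c • v ∈ prefCone C r := by
  obtain ⟨t, ht, x, hx, y, hy, hxy, rfl⟩ := hv
  exact ⟨c * t, by positivity, x, hx, y, hy, hxy, by module⟩

omit H in
theorem cone_smul_iff {v : E} {c : ℝ} (hc : 0 < c) :
    c • v ∈ prefCone C r ↔ v ∈ prefCone C r := by
  refine ⟨fun h => ?_, fun h => cone_smul h hc⟩
  simpa [smul_smul, inv_mul_cancel₀ hc.ne'] using cone_smul h (inv_pos.2 hc)

/-- The cone determines the preference: if `x - y` is a multiple of `x' - y'` with `x'` preferred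
to `y'`, then suitable mixtures of `x, y'` and of `y, x'` coincide, and independence applies. -/
theorem sub_mem_cone {x y : E} (hx : x ∈ C) (hy : y ∈ C) : x - y ∈ prefCone C r ↔ r x y := by
  refine ⟨?_, fun h => ⟨1, one_pos, x, hx, y, hy, h, by simp⟩⟩
  rintro ⟨t, ht, x', hx', y', hy', hxy', he⟩
  have hp : 1 / (1 + t) ∈ Ioo (0 : ℝ) 1 :=
    ⟨by positivity, (div_lt_one (by positivity)).2 (by linarith)⟩
  have hp' : 1 - 1 / (1 + t) ∈ Ioo (0 : ℝ) 1 := ⟨by linarith [hp.2], by linarith [hp.1]⟩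
  have h2 := (H.indep x' hx' y' hy' y hy _ hp').1 hxy'
  have h3 : (1 - 1 / (1 + t)) • x' + (1 - (1 - 1 / (1 + t))) • y
      = (1 / (1 + t)) • x + (1 - 1 / (1 + t)) • y' := by
    rw [eq_add_of_sub_eq he]
    match_scalars <;> field_simp <;> ring
  rw [h3, sub_sub_cancel, add_comm ((1 - 1 / (1 + t)) • y')] at h2
  exact (H.indep x hx y hy y' hy' _ hp).2 h2

theorem zero_mem_cone (hne : C.Nonempty) : (0 : E) ∈ prefCone C r := by
  obtain ⟨x, hx⟩ := hne
  simpa using (H.sub_mem_cone hx hx).2 (H.refl hx)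

theorem cone_total (hne : C.Nonempty) {v : E} (hv : v ∈ diffSpace H.convex hne) :
    v ∈ prefCone C r ∨ -v ∈ prefCone C r := by
  obtain ⟨t, ht, x, hx, y, hy, -, rfl⟩ := hv
  exact (H.total x hx y hy).imp (fun h => ⟨t, ht, x, hx, y, hy, h, rfl⟩)
    (fun h => ⟨t, ht, y, hy, x, hx, h, by module⟩)

/-- Mixture continuity, transported to differences. -/
theorem cone_cont (hne : C.Nonempty) {v w : E} (hv : v ∈ diffSpace H.convex hne)
    (hw : w ∈ diffSpace H.convex hne) (hv0 : -v ∉ prefCone C r) (hw0 : w ∉ prefCone C r) :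
    ∃ q ∈ Ioo (0 : ℝ) 1, ∃ p ∈ Ioo (0 : ℝ) 1,
      -(q • v + (1 - q) • w) ∉ prefCone C r ∧ p • v + (1 - p) • w ∉ prefCone C r := by
  obtain ⟨t, ht, x, hx, y, hy, -, rfl⟩ := hv
  obtain ⟨t', ht', x', hx', y', hy', -, rfl⟩ := hw
  have h0 : t + t' ≠ 0 := by positivity
  set p := t / (t + t') with hpdef
  have hp : p ∈ Ioo (0 : ℝ) 1 := ⟨by positivity, (div_lt_one (by positivity)).2 (by linarith)⟩
  -- `f - g` and `h - g` are the given differences, both divided by `t + t'`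
  set f := p • x + (1 - p) • y' with hf
  set g := p • y + (1 - p) • y' with hg
  set h := p • y + (1 - p) • x' with hh
  have hfC : f ∈ C := H.mix_mem hx hy' hp
  have hgC : g ∈ C := H.mix_mem hy hy' hp
  have hhC : h ∈ C := H.mix_mem hy hx' hp
  have e1 : t • (x - y) = (t + t') • (f - g) := by
    rw [hf, hg, hpdef]; match_scalars <;> field_simp; ring
  have e2 : t' • (x' - y') = (t + t') • (h - g) := by
    rw [hh, hg, hpdef]; match_scalars <;> field_simp <;> ring
  have hpos : 0 < t + t' := by positivity
  rw [e1, ← smul_neg, neg_sub, cone_smul_iff hpos, H.sub_mem_cone hgC hfC] at hv0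
  rw [e2, cone_smul_iff hpos, H.sub_mem_cone hhC hgC] at hw0
  have hfg := (H.total _ hfC _ hgC).resolve_right hv0
  have hgh := (H.total _ hhC _ hgC).resolve_left hw0
  obtain ⟨q, hq, p', hp', h1, h2⟩ := H.cont f hfC g hgC h hhC hfg hv0 hgh hw0
  refine ⟨q, hq, p', hp', ?_, ?_⟩
  · have : -(q • t • (x - y) + (1 - q) • t' • (x' - y'))
        = (t + t') • (g - (q • f + (1 - q) • h)) := by rw [e1, e2]; module
    rwa [this, cone_smul_iff hpos, H.sub_mem_cone hgC (H.mix_mem hfC hhC hq)]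
  · have : p' • t • (x - y) + (1 - p') • t' • (x' - y')
        = (t + t') • ((p' • f + (1 - p') • h) - g) := by rw [e1, e2]; module
    rwa [this, cone_smul_iff hpos, H.sub_mem_cone (H.mix_mem hfC hhC hp') hgC]

/-- Any difference is dominated by a multiple of a strictly positive one. -/
theorem exists_lt_smul (hne : C.Nonempty) {e v : E} (he : e ∈ diffSpace H.convex hne)
    (he0 : -e ∉ prefCone C r) (hv : v ∈ diffSpace H.convex hne) :
    ∃ t : ℝ, v - t • e ∉ prefCone C r := by
  by_cases h : -v ∈ prefCone C r
  · refine ⟨1, fun h1 => he0 ?_⟩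
    have := H.cone_add h1 h
    rwa [show v - (1 : ℝ) • e + -v = -e by module] at this
  · obtain ⟨-, -, p, hp, -, h2⟩ := H.cone_cont hne hv (neg_mem he) h he0
    refine ⟨(1 - p) / p, fun h3 => h2 ?_⟩
    have hp0 := hp.1.ne'
    have := cone_smul h3 hp.1
    rwa [show p • (v - ((1 - p) / p) • e) = p • v + (1 - p) • -e by
      match_scalars <;> field_simp] at this

/-- Measured by a strictly positive difference `e`, every difference has a size `t`; it is the
supremum of the multiples of `e` that lie below it. -/
theorem exists_indiff_smul (hne : C.Nonempty) {e v : E} (he : e ∈ diffSpace H.convex hne)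
    (he0 : -e ∉ prefCone C r) (hv : v ∈ diffSpace H.convex hne) :
    ∃ t : ℝ, v - t • e ∈ prefCone C r ∧ -(v - t • e) ∈ prefCone C r := by
  have hePos : e ∈ prefCone C r := (H.cone_total hne he).resolve_right he0
  have hD : ∀ t : ℝ, v - t • e ∈ diffSpace H.convex hne := fun t =>
    sub_mem hv (Submodule.smul_mem _ _ he)
  have hanti : ∀ t t' : ℝ, t' ≤ t → v - t • e ∈ prefCone C r → v - t' • e ∈ prefCone C r := by
    intro t t' h h1
    rcases h.eq_or_lt with rfl | h
    · exact h1
    have := H.cone_add h1 (cone_smul hePos (sub_pos.2 h))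
    rwa [show v - t • e + (t - t') • e = v - t' • e by module] at this
  set T : Set ℝ := {t | v - t • e ∈ prefCone C r} with hT
  have hub : ∀ t : ℝ, v - t • e ∉ prefCone C r → t ∈ upperBounds T := fun t h t' ht' =>
    le_of_not_ge fun h1 => h (hanti _ _ h1 ht')
  have hTne : T.Nonempty := by
    obtain ⟨t, ht⟩ := H.exists_lt_smul hne he he0 (neg_mem hv)
    refine ⟨-t, ?_⟩
    have h1 := (H.cone_total hne (sub_mem (neg_mem hv) (Submodule.smul_mem _ t he))).resolve_left ht
    rwa [show -(-v - t • e) = v - (-t) • e by module] at h1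
  have hTb : BddAbove T := by
    obtain ⟨t, ht⟩ := H.exists_lt_smul hne he he0 hv
    exact ⟨t, hub t ht⟩
  refine ⟨sSup T, ?_, ?_⟩
  · by_contra h
    obtain ⟨-, -, p, hp, -, h2⟩ := H.cone_cont hne he (hD (sSup T)) he0 h
    have hp1 : 0 < 1 - p := by linarith [hp.2]
    have h3 : sSup T - p / (1 - p) ∈ upperBounds T := hub _ fun h3 => h2 (by
      have := cone_smul h3 hp1
      rwa [show (1 - p) • (v - (sSup T - p / (1 - p)) • e)
        = p • e + (1 - p) • (v - sSup T • e) by match_scalars <;> field_simp; ring] at this)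
    have h4 := csSup_le hTne h3
    have : 0 < p / (1 - p) := div_pos hp.1 hp1
    linarith
  · by_contra h
    obtain ⟨q, hq, -, -, h1, -⟩ := H.cone_cont hne (hD (sSup T)) (neg_mem he) h he0
    have hq1 : 0 < 1 - q := by linarith [hq.2]
    have hq0 := hq.1.ne'
    have h2 : sSup T + (1 - q) / q ∈ T := by
      refine (H.cone_total hne (hD _)).resolve_right fun h3 => h1 ?_
      have := cone_smul h3 hq.1
      rwa [show q • -(v - (sSup T + (1 - q) / q) • e)
        = -(q • (v - sSup T • e) + (1 - q) • -e) by match_scalars <;> field_simp; ring] at this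
    have h4 := le_csSup hTb h2
    have : 0 < (1 - q) / q := div_pos hq1 hq.1
    linarith

end MixtureOrder

end MixtureSpace

/-! ### Expected utility of lotteries -/

section Lotteries

variable {Y : Type*}

theorem expUtility_eq (U : Y → ℝ) (l : Y →₀ ℝ) :
    expUtility U l = Finsupp.linearCombination ℝ U l := by
  simp [expUtility, Finsupp.linearCombination_apply]

theorem expUtility_add (U : Y → ℝ) (k l : Y →₀ ℝ) :
    expUtility U (k + l) = expUtility U k + expUtility U l := by
  simp [expUtility_eq]

theorem expUtility_sub (U : Y → ℝ) (k l : Y →₀ ℝ) :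
    expUtility U (k - l) = expUtility U k - expUtility U l := by
  simp [expUtility_eq]

theorem expUtility_smul (U : Y → ℝ) (p : ℝ) (l : Y →₀ ℝ) :
    expUtility U (p • l) = p * expUtility U l := by
  simp [expUtility_eq]

theorem expUtility_single (U : Y → ℝ) (y : Y) : expUtility U (Finsupp.single y 1) = U y := by
  simp [expUtility_eq]

theorem sum_eq_one {l : Y →₀ ℝ} (hl : l ∈ lotteries Y) :
    Finsupp.linearCombination ℝ (fun _ : Y => (1 : ℝ)) l = 1 := by
  simpa [Finsupp.linearCombination_apply] using hl.2

theorem single_mem_lotteries (y : Y) : Finsupp.single y (1 : ℝ) ∈ lotteries Y := by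
  classical
  refine ⟨fun z => ?_, by simp⟩
  rw [Finsupp.single_apply]; split_ifs <;> simp

theorem convex_lotteries : Convex ℝ (lotteries Y) := by
  intro k hk l hl p q hp hq hpq
  refine ⟨fun y => ?_, ?_⟩
  · have := hk.1 y; have := hl.1 y
    simp only [Finsupp.coe_add, Finsupp.coe_smul, Pi.add_apply, Pi.smul_apply, smul_eq_mul]
    positivity
  · have h := map_add (Finsupp.linearCombination ℝ (fun _ : Y => (1 : ℝ))) (p • k) (q • l)
    rw [map_smul, map_smul, sum_eq_one hk, sum_eq_one hl] at h
    simpa [Finsupp.linearCombination_apply, hpq] using h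

/-- The von Neumann–Morgenstern theorem for lotteries over an arbitrary set of prizes. -/
theorem MixtureOrder.exists_expUtility {r : (Y →₀ ℝ) → (Y →₀ ℝ) → Prop}
    (H : MixtureOrder (lotteries Y) r) :
    ∃ U : Y → ℝ, ∀ k ∈ lotteries Y, ∀ l ∈ lotteries Y,
      (r k l ↔ expUtility U l ≤ expUtility U k) := by
  by_cases htriv : ∀ k ∈ lotteries Y, ∀ l ∈ lotteries Y, r k l
  · refine ⟨fun _ => 0, fun k hk l hl => ⟨fun _ => ?_, fun _ => htriv k hk l hl⟩⟩
    simp [expUtility]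
  push Not at htriv
  obtain ⟨b, hb, a, ha, hba⟩ := htriv
  have hne : (lotteries Y).Nonempty := ⟨a, ha⟩
  have he := sub_mem_diffSpace H.convex hne ha hb
  have he0 : -(a - b) ∉ prefCone (lotteries Y) r := by
    rwa [neg_sub, H.sub_mem_cone hb ha]
  have hePos := (H.cone_total hne he).resolve_right he0
  have hy : ∀ y : Y, Finsupp.single y (1 : ℝ) - b ∈ diffSpace H.convex hne := fun y =>
    sub_mem_diffSpace _ _ (single_mem_lotteries y) hb
  choose U hU using fun y => H.exists_indiff_smul hne he he0 (hy y)
  -- the differences that are indifferent to zero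
  let Z : Submodule ℝ (Y →₀ ℝ) :=
    { carrier := {v | v ∈ prefCone (lotteries Y) r ∧ -v ∈ prefCone (lotteries Y) r}
      zero_mem' := by simpa using H.zero_mem_cone hne
      add_mem' := fun {v w} hv hw =>
        ⟨H.cone_add hv.1 hw.1, by rw [neg_add]; exact H.cone_add hv.2 hw.2⟩
      smul_mem' := by
        intro c v hv
        rcases lt_trichotomy c 0 with h | rfl | h
        · have h' : 0 < -c := by linarith
          exact ⟨by simpa using MixtureOrder.cone_smul hv.2 h',
            by simpa using MixtureOrder.cone_smul hv.1 h'⟩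
        · simpa using H.zero_mem_cone hne
        · exact ⟨MixtureOrder.cone_smul hv.1 h, by simpa using MixtureOrder.cone_smul hv.2 h⟩ }
  have hZ : ∀ k ∈ lotteries Y, k - b - expUtility U k • (a - b) ∈ Z := by
    intro k hk
    have h1 : k.sum (fun y p => p • (Finsupp.single y (1 : ℝ) - b - U y • (a - b))) ∈ Z :=
      Submodule.sum_mem _ fun y _ => Submodule.smul_mem _ _ (hU y)
    convert h1 using 1
    simp only [smul_sub, Finsupp.smul_single, smul_eq_mul, mul_one, smul_smul, Finsupp.sum,
      ← Finset.sum_smul, Finset.sum_sub_distrib]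
    have h2 : ∑ y ∈ k.support, k y = 1 := hk.2
    have h3 : ∑ y ∈ k.support, Finsupp.single y (k y) = k := Finsupp.sum_single k
    rw [h2, h3]
    simp [expUtility, Finsupp.sum]
  refine ⟨U, fun k hk l hl => ?_⟩
  have hZkl := sub_mem (hZ k hk) (hZ l hl)
  rw [show k - b - expUtility U k • (a - b) - (l - b - expUtility U l • (a - b))
    = (k - l) - (expUtility U k - expUtility U l) • (a - b) by module] at hZkl
  rw [← H.sub_mem_cone hk hl]
  constructor
  · intro h
    by_contra! hlt
    have h1 := H.cone_add hZkl.2 h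
    rw [show -(k - l - (expUtility U k - expUtility U l) • (a - b)) + (k - l)
      = (expUtility U l - expUtility U k) • -(a - b) by module,
      MixtureOrder.cone_smul_iff (sub_pos.2 hlt)] at h1
    exact he0 h1
  · intro h
    rcases h.eq_or_lt with h | h
    · simpa [h] using hZkl.1
    · have h1 := H.cone_add hZkl.1 (MixtureOrder.cone_smul hePos (sub_pos.2 h))
      simpa using h1

/-- Expected utilities that order the lotteries alike differ by a positive affine transformation:
both are linear on differences of lotteries, with the same kernel there. -/
theorem exists_affine_of_same_order {U U' : Y → ℝ}
    (h : ∀ k ∈ lotteries Y, ∀ l ∈ lotteries Y,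
      (expUtility U l ≤ expUtility U k ↔ expUtility U' l ≤ expUtility U' k))
    {k l : Y →₀ ℝ} (hk : k ∈ lotteries Y) (hl : l ∈ lotteries Y)
    (hkl : expUtility U k < expUtility U l) :
    ∃ a b : ℝ, 0 < a ∧ ∀ y, U' y = a * U y + b := by
  have hkl' : expUtility U' k < expUtility U' l := by
    rw [← not_le] at hkl ⊢; rwa [← h k hk l hl]
  have hne : (lotteries Y).Nonempty := ⟨k, hk⟩
  have hker : ∀ v ∈ diffSpace convex_lotteries hne, expUtility U v = 0 → expUtility U' v = 0 := by
    rintro _ ⟨t, ht, x, hx, y, hy, -, rfl⟩ h0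
    simp only [expUtility_smul, expUtility_sub, mul_eq_zero, ht.ne', false_or, sub_eq_zero] at h0 ⊢
    exact le_antisymm ((h y hy x hx).1 h0.le) ((h x hx y hy).1 h0.ge)
  have hd : expUtility U l - expUtility U k ≠ 0 := (sub_pos.2 hkl).ne'
  set a := (expUtility U' l - expUtility U' k) / (expUtility U l - expUtility U k) with ha
  refine ⟨a, expUtility U' k - a * expUtility U k, div_pos (sub_pos.2 hkl') (sub_pos.2 hkl),
    fun y => ?_⟩
  have h1 := hker ((Finsupp.single y 1 - k) -
      ((U y - expUtility U k) / (expUtility U l - expUtility U k)) • (l - k))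
    (sub_mem (sub_mem_diffSpace _ _ (single_mem_lotteries y) hk)
      (Submodule.smul_mem _ _ (sub_mem_diffSpace _ _ hl hk)))
    (by
      simp only [expUtility_sub, expUtility_smul, expUtility_single]
      field_simp
      ring)
  simp only [expUtility_sub, expUtility_smul, expUtility_single] at h1
  rw [ha]
  field_simp at h1 ⊢
  linarith

end Lotteries

variable {S Y : Type*}

/-! ### Acts, mixtures and menus -/

theorem mix_apply (p : ℝ) (f g : S → Y →₀ ℝ) (s : S) : mix p f g s = p • f s + (1 - p) • g s :=
  rfl

theorem convex_acts : Convex ℝ (acts S Y) := fun _ hf _ hg _ _ hp hq hpq s =>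
  convex_lotteries (hf s) (hg s) hp hq hpq

theorem constAct_mem_acts {k : Y →₀ ℝ} (hk : k ∈ lotteries Y) : constAct S k ∈ acts S Y :=
  fun _ => hk

theorem mix_mem {A : Set (S → Y →₀ ℝ)} (hA : Convex ℝ A) {f g : S → Y →₀ ℝ} (hf : f ∈ A)
    (hg : g ∈ A) {p : ℝ} (hp : p ∈ Ioo (0 : ℝ) 1) : mix p f g ∈ A :=
  hA hf hg hp.1.le (by linarith [hp.2]) (by ring)

theorem expUtility_mix (U : Y → ℝ) (p : ℝ) (f g : S → Y →₀ ℝ) (s : S) :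
    expUtility U (mix p f g s) = p * expUtility U (f s) + (1 - p) * expUtility U (g s) := by
  rw [mix_apply, expUtility_add, expUtility_smul, expUtility_smul]

theorem convex_setOf_le_expUtility (U : Y → ℝ) (s : S) (r : ℝ) :
    Convex ℝ {f : S → Y →₀ ℝ | r ≤ expUtility U (f s)} := by
  intro f hf g hg p q hp hq hpq
  simp only [mem_ofPred_eq, Pi.add_apply, Pi.smul_apply, expUtility_add, expUtility_smul]
    at hf hg ⊢
  have h1 := mul_le_mul_of_nonneg_left hf hp
  have h2 := mul_le_mul_of_nonneg_left hg hq
  have h3 : r = p * r + q * r := by rw [← add_mul, hpq, one_mul]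
  linarith

namespace IsMenu

variable {M : Set (S → Y →₀ ℝ)}

theorem subset_acts (hM : IsMenu M) : M ⊆ acts S Y := by
  obtain ⟨F, -, -, h, rfl⟩ := hM
  exact convexHull_min h convex_acts

theorem convex (hM : IsMenu M) : Convex ℝ M := by
  obtain ⟨F, -, -, -, rfl⟩ := hM
  exact convex_convexHull ℝ F

theorem of_finite {F : Set (S → Y →₀ ℝ)} (hF : F.Finite) (hne : F.Nonempty)
    (h : F ⊆ acts S Y) : IsMenu (convexHull ℝ F) := ⟨F, hF, hne, h, rfl⟩

theorem union (hM : IsMenu M) {G : Set (S → Y →₀ ℝ)} (hG : G.Finite) (h : G ⊆ acts S Y) :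
    IsMenu (convexHull ℝ (M ∪ G)) := by
  obtain ⟨F, hF, hne, hFa, rfl⟩ := hM
  exact ⟨F ∪ G, hF.union hG, hne.inl, union_subset hFa h, convexHull_convexHull_union_left ..⟩

theorem image (hM : IsMenu M) (φ : (S → Y →₀ ℝ) →ᵃ[ℝ] (S → Y →₀ ℝ))
    (h : ∀ f ∈ acts S Y, φ f ∈ acts S Y) : IsMenu (φ '' M) := by
  obtain ⟨F, hF, hne, hFa, rfl⟩ := hM
  refine ⟨φ '' F, hF.image φ, hne.image φ, ?_, φ.image_convexHull F⟩
  rintro _ ⟨f, hf, rfl⟩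
  exact h f (hFa hf)

theorem image_mix (hM : IsMenu M) {h : S → Y →₀ ℝ} (hh : h ∈ acts S Y) {p : ℝ}
    (hp : p ∈ Ioo (0 : ℝ) 1) : IsMenu ((fun k => mix p k h) '' M) :=
  hM.image (p • AffineMap.id ℝ (S → Y →₀ ℝ) + AffineMap.const ℝ _ ((1 - p) • h))
    fun _ hf => mix_mem convex_acts hf hh hp

theorem image_swapEvents (hM : IsMenu M) (E F : Set S) (e e' : S) :
    IsMenu (swapEvents E F e e' '' M) := by
  classical
  let φ : (S → Y →₀ ℝ) →ₗ[ℝ] (S → Y →₀ ℝ) :=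
    { toFun := swapEvents E F e e'
      map_add' := fun f g => by
        funext s; simp only [swapEvents, Pi.add_apply]; split_ifs <;> rfl
      map_smul' := fun c f => by
        funext s; simp only [swapEvents, Pi.smul_apply, RingHom.id_apply]; split_ifs <;> rfl }
  refine hM.image φ.toAffineMap fun f hf s => ?_
  change swapEvents E F e e' f s ∈ _
  unfold swapEvents
  split_ifs <;> exact hf _

end IsMenu

theorem isMenu_pair {f g : S → Y →₀ ℝ} (hf : f ∈ acts S Y) (hg : g ∈ acts S Y) :
    IsMenu (convexHull ℝ {f, g}) :=
  IsMenu.of_finite (by simp) ⟨f, by simp⟩ (by rintro _ (rfl | rfl) <;> assumption)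

theorem isMenu_triple {f g h : S → Y →₀ ℝ} (hf : f ∈ acts S Y) (hg : g ∈ acts S Y)
    (hh : h ∈ acts S Y) : IsMenu (convexHull ℝ {f, g, h}) :=
  IsMenu.of_finite (by simp) ⟨f, by simp⟩ (by rintro _ (rfl | rfl | rfl) <;> assumption)

theorem mem_convexHull_of_mem {f : S → Y →₀ ℝ} {F : Set (S → Y →₀ ℝ)} (h : f ∈ F) :
    f ∈ convexHull ℝ F := subset_convexHull ℝ F h

/-! ### Worst utilities and safety -/

theorem worstUtility_le (U : Y → ℝ) {M : Set (S → Y →₀ ℝ)} (hM : IsMenu M) {f : S → Y →₀ ℝ}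
    (hf : f ∈ M) (s : S) : worstUtility U M s ≤ expUtility U (f s) :=
  (isLeast_worstUtility U hM s).2 ⟨f, hf, rfl⟩

theorem exists_eq_worstUtility (U : Y → ℝ) {M : Set (S → Y →₀ ℝ)} (hM : IsMenu M) (s : S) :
    ∃ h ∈ M, expUtility U (h s) = worstUtility U M s :=
  (isLeast_worstUtility U hM s).1

theorem worstUtility_eq (U : Y → ℝ) {M : Set (S → Y →₀ ℝ)} {s : S} {c : ℝ}
    (h1 : ∃ h ∈ M, expUtility U (h s) = c) (h2 : ∀ h ∈ M, c ≤ expUtility U (h s)) :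
    worstUtility U M s = c := by
  refine IsLeast.csInf_eq ⟨h1, ?_⟩
  rintro _ ⟨h, hh, rfl⟩
  exact h2 h hh

theorem worstUtility_image_mix (U : Y → ℝ) {M : Set (S → Y →₀ ℝ)} (hM : IsMenu M)
    (h : S → Y →₀ ℝ) {p : ℝ} (hp : 0 ≤ p) (s : S) :
    worstUtility U ((fun k => mix p k h) '' M) s
      = p * worstUtility U M s + (1 - p) * expUtility U (h s) := by
  apply worstUtility_eq
  · obtain ⟨a, ha, h1⟩ := exists_eq_worstUtility U hM s
    exact ⟨_, ⟨a, ha, rfl⟩, by rw [expUtility_mix, h1]⟩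
  · rintro _ ⟨a, ha, rfl⟩
    rw [expUtility_mix]
    have := mul_le_mul_of_nonneg_left (worstUtility_le U hM ha s) hp
    linarith

theorem SafetyAxioms.exists_not_lotteryPref {R : PrefFamily S Y} (hR : SafetyAxioms R) :
    ∃ k ∈ lotteries Y, ∃ l ∈ lotteries Y, ¬ LotteryPref R k l := by
  by_contra! h
  obtain ⟨M, hM, f, hf, g, hg, -, hgf⟩ := hR.nontriviality
  exact hgf (hR.monotonicity M hM g hg f hf fun s =>
    h _ (hM.subset_acts hg s) _ (hM.subset_acts hf s))

section Safety

variable [Fintype S]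

theorem safety_le (U : Y → ℝ) (M : Set (S → Y →₀ ℝ)) (f : S → Y →₀ ℝ) (s : S) :
    safety U M f ≤ expUtility U (f s) - worstUtility U M s :=
  ciInf_le (finite_range _).bddBelow s

variable [Nonempty S]

theorem le_safety_iff (U : Y → ℝ) (M : Set (S → Y →₀ ℝ)) (f : S → Y →₀ ℝ) (c : ℝ) :
    c ≤ safety U M f ↔ ∀ s, c ≤ expUtility U (f s) - worstUtility U M s :=
  le_ciInf_iff (finite_range _).bddBelow

theorem exists_eq_safety (U : Y → ℝ) (M : Set (S → Y →₀ ℝ)) (f : S → Y →₀ ℝ) :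
    ∃ s, expUtility U (f s) - worstUtility U M s = safety U M f :=
  exists_eq_ciInf_of_finite (f := fun s => expUtility U (f s) - worstUtility U M s)

theorem safety_eq_mul (U U' : Y → ℝ) {M M' : Set (S → Y →₀ ℝ)} {f f' : S → Y →₀ ℝ} {p : ℝ}
    (hp : 0 < p) (h : ∀ s, expUtility U' (f' s) - worstUtility U' M' s
      = p * (expUtility U (f s) - worstUtility U M s)) :
    safety U' M' f' = p * safety U M f := by
  apply le_antisymm
  · obtain ⟨s, hs⟩ := exists_eq_safety U M f
    rw [← hs, ← h]; exact safety_le ..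
  · rw [le_safety_iff]
    intro s
    rw [h]
    exact mul_le_mul_of_nonneg_left (safety_le ..) hp.le

theorem le_safety_mix (U : Y → ℝ) (M : Set (S → Y →₀ ℝ)) (f g : S → Y →₀ ℝ) {p : ℝ}
    (hp : p ∈ Ioo (0 : ℝ) 1) :
    p * safety U M f + (1 - p) * safety U M g ≤ safety U M (mix p f g) := by
  rw [le_safety_iff]
  intro s
  rw [expUtility_mix]
  have h1 := mul_le_mul_of_nonneg_left (safety_le U M f s) hp.1.le
  have h2 := mul_le_mul_of_nonneg_left (safety_le U M g s) (sub_nonneg.2 hp.2.le)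
  linarith

theorem safety_constAct_le_iff (U : Y → ℝ) (M : Set (S → Y →₀ ℝ)) (k l : Y →₀ ℝ) :
    safety U M (constAct S l) ≤ safety U M (constAct S k) ↔ expUtility U l ≤ expUtility U k := by
  constructor
  · intro h
    obtain ⟨s, hs⟩ := exists_eq_safety U M (constAct S l)
    have := safety_le U M (constAct S k) s
    simp only [constAct] at hs this h
    linarith
  · intro h
    rw [le_safety_iff]
    intro s
    have := safety_le U M (constAct S l) s
    simp only [constAct] at this ⊢
    linarith

theorem lotteryPref_safetyPref (U : Y → ℝ) (k l : Y →₀ ℝ) :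
    LotteryPref (safetyPref S U) k l ↔ expUtility U l ≤ expUtility U k :=
  safety_constAct_le_iff ..

/-! ### Maximin safety satisfies the axioms -/

theorem exists_weight_lt {a b c : ℝ} (h : b < c) :
    ∃ r ∈ Ioo (0 : ℝ) 1, r * a + (1 - r) * b < c := by
  have h0 : 0 < c - b + |a - b| + 1 := by
    have := abs_nonneg (a - b); linarith
  refine ⟨(c - b) / (c - b + |a - b| + 1), ⟨div_pos (sub_pos.2 h) h0, ?_⟩, ?_⟩
  · rw [div_lt_one h0]
    have := abs_nonneg (a - b); linarith
  · rw [← sub_pos]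
    have h1 : c - ((c - b) / (c - b + |a - b| + 1) * a + (1 - (c - b) / (c - b + |a - b| + 1)) * b)
        = (c - b) * (c - b + (|a - b| - (a - b)) + 1) / (c - b + |a - b| + 1) := by
      field_simp; ring
    rw [h1]
    have := le_abs_self (a - b)
    exact div_pos (mul_pos (sub_pos.2 h) (by linarith)) h0

theorem safetyPref_mixtureContinuity (U : Y → ℝ) : MixtureContinuity (safetyPref S U) := by
  rintro M - f - g - h - ⟨-, hfg⟩ ⟨-, hgh⟩
  simp only [safetyPref, not_le] at hfg hgh
  obtain ⟨q, hq, hq'⟩ := exists_weight_lt (a := -safety U M h) (neg_lt_neg hfg)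
  obtain ⟨s, hs⟩ := exists_eq_safety U M h
  obtain ⟨r, hr, hr'⟩ :=
    exists_weight_lt (a := expUtility U (f s) - worstUtility U M s) hgh
  refine ⟨1 - q, ⟨by linarith [hq.2], by linarith [hq.1]⟩, r, hr, ?_, ?_⟩
  · have h1 := le_safety_mix U M f h (p := 1 - q) ⟨by linarith [hq.2], by linarith [hq.1]⟩
    have h2 : safety U M g < safety U M (mix (1 - q) f h) := by linarith
    exact ⟨h2.le, not_le.2 h2⟩
  · have h1 := safety_le U M (mix r f h) s
    rw [expUtility_mix] at h1
    have h2 : safety U M (mix r f h) < safety U M g := by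
      rw [← hs] at hr'; linarith
    exact ⟨h2.le, not_le.2 h2⟩

theorem safetyPref_independence (U : Y → ℝ) : Independence (safetyPref S U) := by
  intro M hM f _ g _ h _ p hp
  have key : ∀ k, safety U ((fun k => mix p k h) '' M) (mix p k h) = p * safety U M k := fun k =>
    safety_eq_mul U U hp.1 fun s => by
      rw [worstUtility_image_mix U hM h hp.1.le, expUtility_mix]; ring
  simp only [safetyPref, key]
  exact (mul_le_mul_iff_of_pos_left hp.1).symm

theorem safetyPref_symmetry (U : Y → ℝ) : Symmetry (safetyPref S U) := by
  classical
  intro M hM E F hEF e he e' he' hconst f hf g hg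
  let π : S → S := fun s => if s ∈ F then e else if s ∈ E then e' else s
  have hπ : ∀ h : S → Y →₀ ℝ, swapEvents E F e e' h = fun s => h (π s) := by
    intro h; funext s; simp only [swapEvents, π]; split_ifs <;> rfl
  have hw : ∀ s, worstUtility U (swapEvents E F e e' '' M) s = worstUtility U M (π s) := by
    intro s
    simp only [worstUtility, image_image, hπ]
  have hwc : ∀ s t, (∀ h ∈ M, h s = h t) → worstUtility U M s = worstUtility U M t := by
    intro s t hst
    unfold worstUtility
    rw [image_congr fun h hh => by rw [hst h hh]]
  have key : ∀ h ∈ M, safety U (swapEvents E F e e' '' M) (swapEvents E F e e' h)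
      = safety U M h := by
    intro h hh
    apply le_antisymm
    · rw [le_safety_iff]
      intro s
      -- every state is, as far as the acts of the menu can tell, in the range of `π`
      obtain ⟨t, ht⟩ : ∃ t, ∀ a ∈ M, a (π t) = a s := by
        by_cases hsE : s ∈ E
        · refine ⟨e', fun a ha => ?_⟩
          simp only [π, he', if_true]
          exact (hconst a ha).1 _ he _ hsE
        by_cases hsF : s ∈ F
        · refine ⟨e, fun a ha => ?_⟩
          have : e ∉ F := fun h => hEF.ne_of_mem he h rfl
          simp only [π, he, this, if_true, if_false]
          exact (hconst a ha).2 _ he' _ hsF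
        · exact ⟨s, fun a _ => by simp [π, hsE, hsF]⟩
      have := safety_le U (swapEvents E F e e' '' M) (swapEvents E F e e' h) t
      rwa [hw, hwc _ _ ht, congrFun (hπ h) t, ht h hh] at this
    · rw [le_safety_iff]
      intro s
      rw [hw, hπ]
      exact safety_le U M h (π s)
  simp only [safetyPref, key f hf, key g hg]

theorem safetyPref_inwa (U : Y → ℝ) : INWA (safetyPref S U) := by
  intro M hM a ha hnsw f hf g hg
  have hM' := hM.union (finite_singleton a) (singleton_subset_iff.2 ha)
  have hsub : M ⊆ convexHull ℝ (M ∪ {a}) := subset_union_left.trans (subset_convexHull ℝ _)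
  have hw : worstUtility U (convexHull ℝ (M ∪ {a})) = worstUtility U M := by
    funext s
    apply worstUtility_eq
    · obtain ⟨h, hh, h1⟩ := exists_eq_worstUtility U hM s
      exact ⟨h, hsub hh, h1⟩
    · refine fun h hh => convexHull_min (union_subset ?_ (singleton_subset_iff.2 ?_))
        (convex_setOf_le_expUtility U s _) hh
      · exact fun h hh => worstUtility_le U hM hh s
      · obtain ⟨a', ha', h1⟩ := hnsw s
        exact (worstUtility_le U hM ha' s).trans ((lotteryPref_safetyPref U _ _).1 h1)
  have hs : ∀ h, safety U (convexHull ℝ (M ∪ {a})) h = safety U M h := fun h => by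
    simp only [safety, hw]
  simp only [safetyPref, hs]

theorem safetyPref_axioms {U : Y → ℝ} (hU : Nonconstant U) : SafetyAxioms (safetyPref S U) where
  monotonicity := by
    intro M _ f _ g _ h
    refine (le_safety_iff ..).2 fun s => ?_
    have h1 := (lotteryPref_safetyPref U _ _).1 (h s)
    have h2 := safety_le U M g s
    linarith
  completeness := fun _ _ _ _ _ _ => le_total _ _
  nontriviality := by
    obtain ⟨y₁, y₂, h⟩ := hU
    wlog hlt : U y₁ < U y₂ generalizing y₁ y₂
    · exact this y₂ y₁ h.symm (lt_of_le_of_ne (not_lt.1 hlt) h.symm)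
    have h1 := lotteryPref_safetyPref (S := S) U (Finsupp.single y₂ 1) (Finsupp.single y₁ 1)
    have h2 := lotteryPref_safetyPref (S := S) U (Finsupp.single y₁ 1) (Finsupp.single y₂ 1)
    rw [expUtility_single, expUtility_single] at h1 h2
    rw [LotteryPref, pair_comm] at h2
    exact ⟨_, isMenu_pair (constAct_mem_acts (single_mem_lotteries y₂))
      (constAct_mem_acts (single_mem_lotteries y₁)), _, mem_convexHull_of_mem (by simp), _,
      mem_convexHull_of_mem (by simp), h1.2 hlt.le, fun h => hlt.not_ge (h2.1 h)⟩
  mixtureContinuity := safetyPref_mixtureContinuity U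
  transitivity := fun _ _ _ _ _ _ _ _ h1 h2 => le_trans h2 h1
  menuIndependenceConst := fun M M' _ _ k _ l _ _ _ _ _ =>
    (safety_constAct_le_iff U M k l).trans (safety_constAct_le_iff U M' k l).symm
  independence := safetyPref_independence U
  symmetry := safetyPref_symmetry U
  ambiguityAversion := by
    rintro M - f - g - p hp ⟨h1, -⟩
    have h2 := le_safety_mix U M f g hp
    have h3 := mul_le_mul_of_nonneg_left h1 hp.1.le
    change safety U M g ≤ safety U M (mix p f g)
    linarith
  inwa := safetyPref_inwa U

/-! ### Uniqueness of the utility -/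

theorem safetyPref_affine (U U' : Y → ℝ) {a b : ℝ} (ha : 0 < a) (hU : ∀ y, U' y = a * U y + b)
    {M : Set (S → Y →₀ ℝ)} (hM : IsMenu M) {f g : S → Y →₀ ℝ} (hf : f ∈ M) (hg : g ∈ M) :
    safetyPref S U' M f g ↔ safetyPref S U M f g := by
  have hu : ∀ l ∈ lotteries Y, expUtility U' l = a * expUtility U l + b := by
    intro l hl
    have h1 : ∑ y ∈ l.support, l y = 1 := hl.2
    simp only [expUtility, Finsupp.sum, hU, mul_add, Finset.sum_add_distrib, ← Finset.sum_mul, h1,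
      Finset.mul_sum, one_mul]
    congr 1
    exact Finset.sum_congr rfl fun y _ => by ring
  have hw : ∀ s, worstUtility U' M s = a * worstUtility U M s + b := by
    intro s
    apply worstUtility_eq
    · obtain ⟨h, hh, h1⟩ := exists_eq_worstUtility U hM s
      exact ⟨h, hh, by rw [hu _ (hM.subset_acts hh s), h1]⟩
    · intro h hh
      rw [hu _ (hM.subset_acts hh s)]
      have := mul_le_mul_of_nonneg_left (worstUtility_le U hM hh s) ha.le
      linarith
  have key : ∀ h ∈ M, safety U' M h = a * safety U M h := fun h hh =>
    safety_eq_mul U U' ha fun s => by rw [hw, hu _ (hM.subset_acts hh s)]; ring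
  simp only [safetyPref, key f hf, key g hg]
  exact mul_le_mul_iff_of_pos_left ha

theorem IsSafetyFamily.lotteryPref_iff {R : PrefFamily S Y} {U : Y → ℝ} (h : IsSafetyFamily R U)
    {k l : Y →₀ ℝ} (hk : k ∈ lotteries Y) (hl : l ∈ lotteries Y) :
    LotteryPref R k l ↔ expUtility U l ≤ expUtility U k :=
  (h _ (isMenu_pair (constAct_mem_acts hk) (constAct_mem_acts hl)) _
    (mem_convexHull_of_mem (by simp)) _ (mem_convexHull_of_mem (by simp))).trans
    (lotteryPref_safetyPref U k l)

theorem IsSafetyFamily.iff_affine {R : PrefFamily S Y} (hR : SafetyAxioms R) {U : Y → ℝ}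
    (hU : IsSafetyFamily R U) (U' : Y → ℝ) :
    IsSafetyFamily R U' ↔ ∃ a b : ℝ, 0 < a ∧ ∀ y, U' y = a * U y + b := by
  constructor
  · intro hU'
    obtain ⟨k, hk, l, hl, hkl⟩ := hR.exists_not_lotteryPref
    rw [hU.lotteryPref_iff hk hl, not_le] at hkl
    exact exists_affine_of_same_order (fun k hk l hl =>
      (hU.lotteryPref_iff hk hl).symm.trans (hU'.lotteryPref_iff hk hl)) hk hl hkl
  · rintro ⟨a, b, ha, h⟩ M hM f hf g hg
    rw [hU M hM f hf g hg, safetyPref_affine U U' ha h hM hf hg]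

end Safety

/-! ### The preference between lotteries has an expected utility -/

section

variable {R : PrefFamily S Y} (hR : SafetyAxioms R)
include hR

theorem SafetyAxioms.lotteryPref_iff {M : Set (S → Y →₀ ℝ)} (hM : IsMenu M) {k l : Y →₀ ℝ}
    (hk : k ∈ lotteries Y) (hl : l ∈ lotteries Y) (hkM : constAct S k ∈ M)
    (hlM : constAct S l ∈ M) : R M (constAct S k) (constAct S l) ↔ LotteryPref R k l :=
  hR.menuIndependenceConst _ _ hM (isMenu_pair (constAct_mem_acts hk) (constAct_mem_acts hl)) k hk
    l hl hkM hlM (mem_convexHull_of_mem (by simp)) (mem_convexHull_of_mem (by simp))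

theorem SafetyAxioms.mixtureOrder : MixtureOrder (lotteries Y) (LotteryPref R) where
  convex := convex_lotteries
  total k hk l hl := by
    have hM := isMenu_pair (constAct_mem_acts (S := S) hk) (constAct_mem_acts hl)
    have hkM : constAct S k ∈ convexHull ℝ {constAct S k, constAct S l} :=
      mem_convexHull_of_mem (by simp)
    have hlM : constAct S l ∈ convexHull ℝ {constAct S k, constAct S l} :=
      mem_convexHull_of_mem (by simp)
    rw [← hR.lotteryPref_iff hM hk hl hkM hlM, ← hR.lotteryPref_iff hM hl hk hlM hkM]
    exact hR.completeness _ hM _ hkM _ hlM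
  trans k hk l hl m hm := by
    have hM := isMenu_triple (constAct_mem_acts (S := S) hk) (constAct_mem_acts hl)
      (constAct_mem_acts hm)
    set M := convexHull ℝ {constAct S k, constAct S l, constAct S m}
    have hkM : constAct S k ∈ M := mem_convexHull_of_mem (by simp)
    have hlM : constAct S l ∈ M := mem_convexHull_of_mem (by simp)
    have hmM : constAct S m ∈ M := mem_convexHull_of_mem (by simp)
    rw [← hR.lotteryPref_iff hM hk hl hkM hlM, ← hR.lotteryPref_iff hM hl hm hlM hmM,
      ← hR.lotteryPref_iff hM hk hm hkM hmM]
    exact hR.transitivity _ hM _ hkM _ hlM _ hmM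
  indep k hk l hl m hm p hp := by
    have hM := isMenu_pair (constAct_mem_acts (S := S) hk) (constAct_mem_acts hl)
    have hkM : constAct S k ∈ convexHull ℝ {constAct S k, constAct S l} :=
      mem_convexHull_of_mem (by simp)
    have hlM : constAct S l ∈ convexHull ℝ {constAct S k, constAct S l} :=
      mem_convexHull_of_mem (by simp)
    have hm' := constAct_mem_acts (S := S) hm
    have hp1 : 0 ≤ 1 - p := by linarith [hp.2]
    rw [← hR.lotteryPref_iff hM hk hl hkM hlM, hR.independence _ hM _ hkM _ hlM _ hm' p hp]
    exact hR.lotteryPref_iff (hM.image_mix hm' hp)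
      (convex_lotteries hk hm hp.1.le hp1 (by ring)) (convex_lotteries hl hm hp.1.le hp1 (by ring))
      ⟨_, hkM, rfl⟩ ⟨_, hlM, rfl⟩
  cont k hk l hl m hm hkl hlk hlm hml := by
    have hM := isMenu_triple (constAct_mem_acts (S := S) hk) (constAct_mem_acts hl)
      (constAct_mem_acts hm)
    set M := convexHull ℝ {constAct S k, constAct S l, constAct S m}
    have hkM : constAct S k ∈ M := mem_convexHull_of_mem (by simp)
    have hlM : constAct S l ∈ M := mem_convexHull_of_mem (by simp)
    have hmM : constAct S m ∈ M := mem_convexHull_of_mem (by simp)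
    rw [← hR.lotteryPref_iff hM hk hl hkM hlM] at hkl
    rw [← hR.lotteryPref_iff hM hl hk hlM hkM] at hlk
    rw [← hR.lotteryPref_iff hM hl hm hlM hmM] at hlm
    rw [← hR.lotteryPref_iff hM hm hl hmM hlM] at hml
    obtain ⟨q, hq, p, hp, h1, h2⟩ :=
      hR.mixtureContinuity _ hM _ hkM _ hlM _ hmM ⟨hkl, hlk⟩ ⟨hlm, hml⟩
    have hmix : ∀ p ∈ Ioo (0 : ℝ) 1, p • k + (1 - p) • m ∈ lotteries Y ∧
        constAct S (p • k + (1 - p) • m) ∈ M := fun p hp =>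
      ⟨convex_lotteries hk hm hp.1.le (by linarith [hp.2]) (by ring),
        mix_mem hM.convex hkM hmM hp⟩
    refine ⟨q, hq, p, hp, ?_, ?_⟩
    · rw [← hR.lotteryPref_iff hM hl (hmix q hq).1 hlM (hmix q hq).2]
      exact h1.2
    · rw [← hR.lotteryPref_iff hM (hmix p hp).1 hl (hmix p hp).2 hlM]
      exact h2.2

/-! ### Enlarging a menu by acts that are never strictly worst -/

theorem SafetyAxioms.pref_union_iff {M : Set (S → Y →₀ ℝ)} (hM : IsMenu M)
    {G : Set (S → Y →₀ ℝ)} (hG : G.Finite) (hGa : G ⊆ acts S Y)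
    (hnsw : ∀ a ∈ G, NeverStrictlyWorst R M a) {f g : S → Y →₀ ℝ} (hf : f ∈ M) (hg : g ∈ M) :
    R M f g ↔ R (convexHull ℝ (M ∪ G)) f g := by
  induction G, hG using Set.Finite.induction_on with
  | empty => rw [union_empty, hM.convex.convexHull_eq]
  | @insert a G _ hG ih =>
    rw [insert_subset_iff] at hGa
    have hsub : M ⊆ convexHull ℝ (M ∪ G) := subset_union_left.trans (subset_convexHull ℝ _)
    rw [ih hGa.2 fun b hb => hnsw b (mem_insert_of_mem _ hb),
      hR.inwa _ (hM.union hG hGa.2) a hGa.1 ?_ f (hsub hf) g (hsub hg),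
      convexHull_convexHull_union_left, union_assoc, union_singleton]
    intro s
    obtain ⟨b, hb, h⟩ := hnsw a (mem_insert _ _) s
    exact ⟨b, hsub hb, h⟩

end

/-! ### Menus with the same worst utility in every state -/

/-- The acts whose utility is in every state at least that of the lottery `c`. -/
def actsAbove (S : Type*) (U : Y → ℝ) (c : Y →₀ ℝ) : Set (S → Y →₀ ℝ) :=
  {f | f ∈ acts S Y ∧ ∀ s, expUtility U c ≤ expUtility U (f s)}

/-- A flat menu with floor `c`: it contains the constant act `c`, which is worst in every state. -/
structure IsFlat (U : Y → ℝ) (c : Y →₀ ℝ) (M : Set (S → Y →₀ ℝ)) : Prop where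
  isMenu : IsMenu M
  const_mem : constAct S c ∈ M
  above : M ⊆ actsAbove S U c

/-- Preference between acts that lie above `c`, in the smallest flat menu with floor `c` that
contains them. -/
def FlatPref (R : PrefFamily S Y) (c : Y →₀ ℝ) (f g : S → Y →₀ ℝ) : Prop :=
  R (convexHull ℝ {f, g, constAct S c}) f g

theorem convex_actsAbove (U : Y → ℝ) (c : Y →₀ ℝ) : Convex ℝ (actsAbove S U c) := by
  intro f hf g hg p q hp hq hpq
  exact ⟨convex_acts hf.1 hg.1 hp hq hpq,
    fun s => convex_setOf_le_expUtility U s _ (hf.2 s) (hg.2 s) hp hq hpq⟩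

theorem constAct_mem_actsAbove {U : Y → ℝ} {c k : Y →₀ ℝ} (hk : k ∈ lotteries Y)
    (h : expUtility U c ≤ expUtility U k) : constAct S k ∈ actsAbove S U c :=
  ⟨constAct_mem_acts hk, fun _ => h⟩

theorem IsFlat.of_finite {U : Y → ℝ} {c : Y →₀ ℝ} {G : Set (S → Y →₀ ℝ)} (hG : G.Finite)
    (hc : constAct S c ∈ G) (h : G ⊆ actsAbove S U c) : IsFlat U c (convexHull ℝ G) :=
  ⟨.of_finite hG ⟨_, hc⟩ fun _ hf => (h hf).1, subset_convexHull ℝ _ hc,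
    convexHull_min h (convex_actsAbove U c)⟩

/-- The act that yields `k` in the state `s` and `b` in all other states. -/
noncomputable def singleOut (s : S) (k b : Y →₀ ℝ) : S → Y →₀ ℝ :=
  open Classical in fun t => if t = s then k else b

theorem singleOut_self (s : S) (k b : Y →₀ ℝ) : singleOut s k b s = k := by
  simp [singleOut]

theorem singleOut_of_ne {s t : S} (h : t ≠ s) (k b : Y →₀ ℝ) : singleOut s k b t = b := by
  simp [singleOut, h]

theorem singleOut_mem {U : Y → ℝ} {c : Y →₀ ℝ} {k b : Y →₀ ℝ} (hk : k ∈ lotteries Y)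
    (hb : b ∈ lotteries Y) (hck : expUtility U c ≤ expUtility U k)
    (hcb : expUtility U c ≤ expUtility U b) (s : S) : singleOut s k b ∈ actsAbove S U c := by
  refine ⟨fun t => ?_, fun t => ?_⟩ <;> unfold singleOut <;> split_ifs <;> assumption

section

variable {R : PrefFamily S Y} (hR : SafetyAxioms R) {U : Y → ℝ}
  (hU : ∀ k ∈ lotteries Y, ∀ l ∈ lotteries Y,
    (LotteryPref R k l ↔ expUtility U l ≤ expUtility U k))
  {c : Y →₀ ℝ} (hc : c ∈ lotteries Y)
include hR hU hc

/-- Flat menus with the same floor rank their common acts alike: acts above the floor are never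
strictly worst, so both menus can be enlarged to the menu that they generate together. -/
theorem IsFlat.pref_iff_pref {M M' : Set (S → Y →₀ ℝ)} (hM : IsFlat U c M) (hM' : IsFlat U c M')
    {f g : S → Y →₀ ℝ} (hf : f ∈ M) (hg : g ∈ M) (hf' : f ∈ M') (hg' : g ∈ M') :
    R M f g ↔ R M' f g := by
  have key : ∀ {M M' : Set (S → Y →₀ ℝ)}, IsFlat U c M → IsFlat U c M' →
      ∀ {F : Set (S → Y →₀ ℝ)}, F.Finite → M' = convexHull ℝ F → f ∈ M → g ∈ M →
      (R M f g ↔ R (convexHull ℝ (M ∪ M')) f g) := by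
    intro M M' hM hM' F hF hMF hf hg
    have hFM : F ⊆ M' := hMF ▸ subset_convexHull ℝ F
    rw [hR.pref_union_iff hM.isMenu hF (fun a ha => (hM'.above (hFM ha)).1) ?_ hf hg, hMF,
      convexHull_convexHull_union_right]
    exact fun a ha s => ⟨_, hM.const_mem,
      (hU _ ((hM'.above (hFM ha)).1 s) _ hc).2 ((hM'.above (hFM ha)).2 s)⟩
  obtain ⟨F, hF, -, -, hMF⟩ := id hM.isMenu
  obtain ⟨F', hF', -, -, hMF'⟩ := id hM'.isMenu
  rw [key hM hM' hF' hMF' hf hg, key hM' hM hF hMF hf' hg', union_comm]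

theorem IsFlat.pref_iff {M : Set (S → Y →₀ ℝ)} (hM : IsFlat U c M) {f g : S → Y →₀ ℝ}
    (hf : f ∈ M) (hg : g ∈ M) : R M f g ↔ FlatPref R c f g := by
  refine hM.pref_iff_pref hR hU hc (.of_finite (by simp) (by simp) ?_) hf hg
    (mem_convexHull_of_mem (by simp)) (mem_convexHull_of_mem (by simp))
  rintro _ (rfl | rfl | rfl)
  exacts [hM.above hf, hM.above hg, hM.above hM.const_mem]

omit hR hU in
/-- Finitely many acts above `c` lie in a common flat menu with floor `c`. -/
theorem exists_isFlat {G : Set (S → Y →₀ ℝ)} (hG : G.Finite) (h : G ⊆ actsAbove S U c) :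
    ∃ M, IsFlat U c M ∧ G ⊆ M :=
  ⟨convexHull ℝ (insert (constAct S c) G), .of_finite (hG.insert _) (mem_insert _ _)
    (insert_subset (constAct_mem_actsAbove hc le_rfl) h),
    (subset_insert _ _).trans (subset_convexHull ℝ _)⟩

variable {f g h : S → Y →₀ ℝ} (hf : f ∈ actsAbove S U c) (hg : g ∈ actsAbove S U c)
  (hh : h ∈ actsAbove S U c)

include hf hg

theorem flatPref_total : FlatPref R c f g ∨ FlatPref R c g f := by
  obtain ⟨M, hM, hGM⟩ := exists_isFlat hc (G := {f, g}) (by simp) (pair_subset hf hg)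
  have hfM : f ∈ M := hGM (by simp)
  have hgM : g ∈ M := hGM (by simp)
  rw [← hM.pref_iff hR hU hc hfM hgM, ← hM.pref_iff hR hU hc hgM hfM]
  exact hR.completeness _ hM.isMenu _ hfM _ hgM

theorem flatPref_mono (hfg : ∀ s, expUtility U (g s) ≤ expUtility U (f s)) :
    FlatPref R c f g := by
  obtain ⟨M, hM, hGM⟩ := exists_isFlat hc (G := {f, g}) (by simp) (pair_subset hf hg)
  have hfM : f ∈ M := hGM (by simp)
  have hgM : g ∈ M := hGM (by simp)
  rw [← hM.pref_iff hR hU hc hfM hgM]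
  exact hR.monotonicity _ hM.isMenu _ hfM _ hgM fun s => (hU _ (hf.1 s) _ (hg.1 s)).2 (hfg s)

theorem flatPref_mix (h1 : FlatPref R c f g) (h2 : FlatPref R c g f) {p : ℝ}
    (hp : p ∈ Ioo (0 : ℝ) 1) : FlatPref R c (mix p f g) g := by
  obtain ⟨M, hM, hGM⟩ := exists_isFlat hc (G := {f, g}) (by simp) (pair_subset hf hg)
  have hfM : f ∈ M := hGM (by simp)
  have hgM : g ∈ M := hGM (by simp)
  rw [← hM.pref_iff hR hU hc hfM hgM] at h1
  rw [← hM.pref_iff hR hU hc hgM hfM] at h2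
  rw [← hM.pref_iff hR hU hc (mix_mem hM.isMenu.convex hfM hgM hp) hgM]
  exact hR.ambiguityAversion _ hM.isMenu _ hfM _ hgM _ hp ⟨h1, h2⟩

include hh

theorem flatPref_trans (h1 : FlatPref R c f g) (h2 : FlatPref R c g h) : FlatPref R c f h := by
  obtain ⟨M, hM, hGM⟩ := exists_isFlat hc (G := {f, g, h}) (by simp)
    (insert_subset hf (pair_subset hg hh))
  have hfM : f ∈ M := hGM (by simp)
  have hgM : g ∈ M := hGM (by simp)
  have hhM : h ∈ M := hGM (by simp)
  rw [← hM.pref_iff hR hU hc hfM hgM] at h1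
  rw [← hM.pref_iff hR hU hc hgM hhM] at h2
  rw [← hM.pref_iff hR hU hc hfM hhM]
  exact hR.transitivity _ hM.isMenu _ hfM _ hgM _ hhM h1 h2

theorem flatPref_cont (h1 : ¬ FlatPref R c g f) (h2 : ¬ FlatPref R c h g) :
    ∃ r ∈ Ioo (0 : ℝ) 1, ¬ FlatPref R c (mix r f h) g := by
  obtain ⟨M, hM, hGM⟩ := exists_isFlat hc (G := {f, g, h}) (by simp)
    (insert_subset hf (pair_subset hg hh))
  have hfM : f ∈ M := hGM (by simp)
  have hgM : g ∈ M := hGM (by simp)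
  have hhM : h ∈ M := hGM (by simp)
  rw [← hM.pref_iff hR hU hc hgM hfM] at h1
  rw [← hM.pref_iff hR hU hc hhM hgM] at h2
  obtain ⟨-, -, r, hr, -, h3⟩ := hR.mixtureContinuity _ hM.isMenu _ hfM _ hgM _ hhM
    ⟨(hR.completeness _ hM.isMenu _ hfM _ hgM).resolve_right h1, h1⟩
    ⟨(hR.completeness _ hM.isMenu _ hgM _ hhM).resolve_right h2, h2⟩
  refine ⟨r, hr, fun h4 => h3.2 ?_⟩
  rwa [hM.pref_iff hR hU hc (mix_mem hM.isMenu.convex hfM hhM hr) hgM]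

omit hf hg hh

theorem flatPref_const_iff {k l : Y →₀ ℝ} (hk : k ∈ lotteries Y) (hl : l ∈ lotteries Y)
    (hck : expUtility U c ≤ expUtility U k) (hcl : expUtility U c ≤ expUtility U l) :
    FlatPref R c (constAct S k) (constAct S l) ↔ expUtility U l ≤ expUtility U k := by
  obtain ⟨M, hM, hGM⟩ := exists_isFlat hc (G := {constAct S k, constAct S l}) (by simp)
    (pair_subset (constAct_mem_actsAbove hk hck) (constAct_mem_actsAbove hl hcl))
  have hkM : constAct S k ∈ M := hGM (by simp)
  have hlM : constAct S l ∈ M := hGM (by simp)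
  rw [← hM.pref_iff hR hU hc hkM hlM, hR.lotteryPref_iff hM.isMenu hk hl hkM hlM, hU k hk l hl]

include hf

/-- An act is indifferent to the act obtained from it by exchanging its values on two events on
which it is constant: the exchange is an involution, so symmetry makes either preference between
the two acts imply the other. -/
theorem flatPref_swapEvents {E F : Set S} (hEF : Disjoint E F) {e e' : S} (he : e ∈ E)
    (he' : e' ∈ F) (hE : ConstantOn E f) (hF : ConstantOn F f) :
    FlatPref R c f (swapEvents E F e e' f) ∧ FlatPref R c (swapEvents E F e e' f) f := by
  have onE : ∀ h : S → Y →₀ ℝ, ∀ s ∈ E, swapEvents E F e e' h s = h e' := fun h s hs => by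
    have hsF : s ∉ F := fun h' => hEF.ne_of_mem hs h' rfl
    simp [swapEvents, hs, hsF]
  have onF : ∀ h : S → Y →₀ ℝ, ∀ s ∈ F, swapEvents E F e e' h s = h e := fun h s hs => by
    simp [swapEvents, hs]
  have off : ∀ h : S → Y →₀ ℝ, ∀ s, s ∉ E → s ∉ F → swapEvents E F e e' h s = h s :=
    fun h s h1 h2 => by simp [swapEvents, h1, h2]
  have hval : ∀ h : S → Y →₀ ℝ, ∀ s, ∃ t, swapEvents E F e e' h s = h t := fun h s => by
    unfold swapEvents; split_ifs <;> exact ⟨_, rfl⟩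
  have habove : ∀ h ∈ actsAbove S U c, swapEvents E F e e' h ∈ actsAbove S U c := by
    refine fun h hh => ⟨fun s => ?_, fun s => ?_⟩ <;> obtain ⟨t, ht⟩ := hval h s <;> rw [ht]
    exacts [hh.1 t, hh.2 t]
  have hinv : swapEvents E F e e' (swapEvents E F e e' f) = f := by
    funext s
    by_cases hsE : s ∈ E
    · rw [onE _ s hsE, onF _ _ he', hE _ he _ hsE]
    by_cases hsF : s ∈ F
    · rw [onF _ s hsF, onE _ _ he, hF _ he' _ hsF]
    · rw [off _ s hsE hsF, off _ s hsE hsF]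
  set f' := swapEvents E F e e' f with hf'
  have hf'A := habove f hf
  have hM : IsFlat U c (convexHull ℝ {f, f', constAct S c}) := by
    refine .of_finite (by simp) (by simp) ?_
    exact insert_subset hf (pair_subset hf'A (constAct_mem_actsAbove hc le_rfl))
  have hM' : IsFlat U c (swapEvents E F e e' '' convexHull ℝ {f, f', constAct S c}) := by
    refine ⟨hM.isMenu.image_swapEvents E F e e', ⟨_, hM.const_mem, ?_⟩, ?_⟩
    · funext s
      obtain ⟨t, ht⟩ := hval (constAct S c) s
      exact ht
    · rintro _ ⟨h, hh, rfl⟩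
      exact habove h (hM.above hh)
  have hconst : ∀ h ∈ convexHull ℝ {f, f', constAct S c}, ConstantOn E h ∧ ConstantOn F h := by
    have hconv : Convex ℝ {h : S → Y →₀ ℝ | ConstantOn E h ∧ ConstantOn F h} := by
      intro h1 hh1 h2 hh2 p q _ _ _
      exact ⟨fun s hs t ht => by simp [hh1.1 s hs t ht, hh2.1 s hs t ht],
        fun s hs t ht => by simp [hh1.2 s hs t ht, hh2.2 s hs t ht]⟩
    refine fun h hh => convexHull_min (insert_subset ?_ (pair_subset ?_ ?_)) hconv hh
    · exact ⟨hE, hF⟩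
    · exact ⟨fun s hs t ht => by rw [hf', onE _ _ hs, onE _ _ ht],
        fun s hs t ht => by rw [hf', onF _ _ hs, onF _ _ ht]⟩
    · exact ⟨fun _ _ _ _ => rfl, fun _ _ _ _ => rfl⟩
  have hfM : f ∈ convexHull ℝ {f, f', constAct S c} := mem_convexHull_of_mem (by simp)
  have hfM' : f' ∈ convexHull ℝ {f, f', constAct S c} := mem_convexHull_of_mem (by simp)
  have hsymm := hR.symmetry _ hM.isMenu E F hEF e he e' he' hconst f hfM f' hfM'
  rw [hM.pref_iff hR hU hc hfM hfM', hM'.pref_iff hR hU hc ⟨_, hfM, rfl⟩ ⟨_, hfM', rfl⟩, hinv,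
    ← hf'] at hsymm
  rcases flatPref_total hR hU hc hf hf'A with h | h
  exacts [⟨h, hsymm.1 h⟩, ⟨hsymm.2 h, h⟩]

omit hf

variable {k b : Y →₀ ℝ} (hk : k ∈ lotteries Y) (hb : b ∈ lotteries Y)
  (hck : expUtility U c ≤ expUtility U k) (hkb : expUtility U k ≤ expUtility U b)
include hk hb hck hkb

/-- Bringing the better value `b` halfway down to the worst value `k` does no harm. By symmetry
under exchanging `s` with its complement, the act that is `k` only at `s` is as good as the acts
that are `b` only at `t`, or only at `r`; these two hedge each other. -/
theorem flatPref_halve {s t r : S} (hst : t ≠ s) (hsr : r ≠ s) (htr : t ≠ r) :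
    FlatPref R c (singleOut s k ((1 / 2 : ℝ) • k + (1 - 1 / 2 : ℝ) • b)) (singleOut s k b) := by
  have hcb := hck.trans hkb
  have hhalf : (1 / 2 : ℝ) ∈ Ioo (0 : ℝ) 1 := by norm_num
  set m := (1 / 2 : ℝ) • k + (1 - 1 / 2 : ℝ) • b with hm
  have hmL : m ∈ lotteries Y := convex_lotteries hk hb (by norm_num) (by norm_num) (by norm_num)
  have hum : expUtility U m = 1 / 2 * expUtility U k + 1 / 2 * expUtility U b := by
    rw [hm, expUtility_add, expUtility_smul, expUtility_smul]; norm_num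
  have hcm : expUtility U c ≤ expUtility U m := by linarith
  have hx := singleOut_mem (S := S) hk hb hck hcb
  have ha := singleOut_mem (S := S) hb hk hcb hck
  have hxm := singleOut_mem (S := S) hk hmL hck hcm
  have swap1 : FlatPref R c (singleOut s b k) (singleOut s k b) := by
    have h := flatPref_swapEvents hR hU hc (hx s) (E := {s}) (F := {s}ᶜ) disjoint_compl_right rfl
      hst (by rintro _ rfl _ rfl; rfl)
      (fun p hp q hq => by rw [singleOut_of_ne hp, singleOut_of_ne hq])
    have he : swapEvents {s} {s}ᶜ s t (singleOut s k b) = singleOut s b k := by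
      funext q
      by_cases hq : q = s
      · subst hq; simp [swapEvents, singleOut, hst]
      · simp [swapEvents, singleOut, hq]
    rw [he] at h
    exact h.2
  have swap2 : ∀ p q : S, p ≠ q → FlatPref R c (singleOut p b k) (singleOut q b k) := by
    intro p q hpq
    have h := flatPref_swapEvents hR hU hc (ha p) (E := {p}) (F := {q})
      (disjoint_singleton.2 hpq) rfl rfl (by rintro _ rfl _ rfl; rfl) (by rintro _ rfl _ rfl; rfl)
    have he : swapEvents {p} {q} p q (singleOut p b k) = singleOut q b k := by
      funext z
      simp only [swapEvents, singleOut, mem_singleton_iff]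
      by_cases hz : z = q
      · simp [hz]
      · by_cases hz' : z = p
        · simp [hz', hpq, hpq.symm]
        · simp [hz, hz']
    rw [he] at h
    exact h.1
  have hmix := flatPref_mix hR hU hc (ha t) (ha r) (swap2 t r htr) (swap2 r t htr.symm) hhalf
  have hmixA := mix_mem (convex_actsAbove U c) (ha t) (ha r) hhalf
  have hdom : FlatPref R c (singleOut s k m)
      (mix (1 / 2) (singleOut t b k) (singleOut r b k)) := by
    refine flatPref_mono hR hU hc (hxm s) hmixA fun z => ?_
    rw [expUtility_mix]
    by_cases hzs : z = s
    · subst hzs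
      rw [singleOut_self, singleOut_of_ne hst.symm, singleOut_of_ne hsr.symm]
      linarith
    rw [singleOut_of_ne hzs, hum]
    by_cases hzt : z = t
    · subst hzt
      rw [singleOut_self, singleOut_of_ne htr]
      linarith
    by_cases hzr : z = r
    · subst hzr
      rw [singleOut_self, singleOut_of_ne hzt]
      linarith
    · rw [singleOut_of_ne hzt, singleOut_of_ne hzr]
      linarith
  have h1 := flatPref_trans hR hU hc (hxm s) hmixA (ha r) hdom hmix
  have h2 := flatPref_trans hR hU hc (hxm s) (ha r) (ha s) h1 (swap2 r s hsr)
  exact flatPref_trans hR hU hc (hxm s) (ha s) (hx s) h2 swap1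

/-- An act that yields the lottery `k` in one state and a better one elsewhere is no better than
`k`: by repeated halving the better lottery can be brought arbitrarily close to `k`, and mixture
continuity excludes a jump in the limit. -/
theorem flatPref_const_singleOut {s t r : S} (hst : t ≠ s) (hsr : r ≠ s) (htr : t ≠ r) :
    FlatPref R c (constAct S k) (singleOut s k b) := by
  have hcb := hck.trans hkb
  have hx := singleOut_mem (S := S) hk hb hck hcb s
  have hkA : constAct S k ∈ actsAbove S U c := constAct_mem_actsAbove hk hck
  rcases hkb.eq_or_lt with heq | hlt
  · refine flatPref_mono hR hU hc hkA hx fun z => ?_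
    unfold singleOut constAct
    split_ifs
    exacts [le_rfl, heq.ge]
  -- lotteries `2⁻ʲ` of the way from `k` to `b` whose constant acts still are at least as good
  have hseq : ∀ j : ℕ, ∃ l ∈ lotteries Y,
      expUtility U l = expUtility U k + (1 / 2) ^ j * (expUtility U b - expUtility U k) ∧
      FlatPref R c (constAct S l) (singleOut s k b) := by
    have hseq' : ∀ j : ℕ, ∃ l ∈ lotteries Y,
        expUtility U l = expUtility U k + (1 / 2) ^ j * (expUtility U b - expUtility U k) ∧
        FlatPref R c (singleOut s k l) (singleOut s k b) := by
      intro j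
      induction j with
      | zero => exact ⟨b, hb, by ring, flatPref_mono hR hU hc hx hx fun _ => le_rfl⟩
      | succ j ih =>
        obtain ⟨l, hl, hul, hlx⟩ := ih
        have hkl : expUtility U k ≤ expUtility U l := by
          have : 0 ≤ (1 / 2 : ℝ) ^ j * (expUtility U b - expUtility U k) :=
            mul_nonneg (by positivity) (sub_nonneg.2 hkb)
          linarith
        have hm : (1 / 2 : ℝ) • k + (1 - 1 / 2 : ℝ) • l ∈ lotteries Y :=
          convex_lotteries hk hl (by norm_num) (by norm_num) (by norm_num)
        have hum : expUtility U ((1 / 2 : ℝ) • k + (1 - 1 / 2 : ℝ) • l)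
            = expUtility U k + (1 / 2) ^ (j + 1) * (expUtility U b - expUtility U k) := by
          rw [expUtility_add, expUtility_smul, expUtility_smul, hul]; ring
        refine ⟨_, hm, hum, ?_⟩
        have hcm : expUtility U c ≤ expUtility U ((1 / 2 : ℝ) • k + (1 - 1 / 2 : ℝ) • l) := by
          rw [expUtility_add, expUtility_smul, expUtility_smul]; linarith
        exact flatPref_trans hR hU hc (singleOut_mem hk hm hck hcm s)
          (singleOut_mem hk hl hck (hck.trans hkl) s) hx
          (flatPref_halve hR hU hc hk hl hck hkl hst hsr htr) hlx
    intro j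
    obtain ⟨l, hl, hul, hlx⟩ := hseq' j
    have hkl : expUtility U k ≤ expUtility U l := by
      have : 0 ≤ (1 / 2 : ℝ) ^ j * (expUtility U b - expUtility U k) :=
        mul_nonneg (by positivity) (sub_nonneg.2 hkb)
      linarith
    have hlA : constAct S l ∈ actsAbove S U c := constAct_mem_actsAbove hl (hck.trans hkl)
    have hslA := singleOut_mem (S := S) hk hl hck (hck.trans hkl) s
    refine ⟨l, hl, hul, flatPref_trans hR hU hc hlA hslA hx
      (flatPref_mono hR hU hc hlA hslA fun z => ?_) hlx⟩
    unfold singleOut constAct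
    split_ifs
    exacts [hkl, le_rfl]
  by_contra hcon
  have hd : 0 < expUtility U b - expUtility U k := sub_pos.2 hlt
  obtain ⟨l₁, hl₁, hul₁, -⟩ := hseq 1
  obtain ⟨l₂, hl₂, hul₂, h₂⟩ := hseq 2
  have hcl₁ : expUtility U c ≤ expUtility U l₁ := by rw [hul₁]; linarith
  have hcl₂ : expUtility U c ≤ expUtility U l₂ := by rw [hul₂]; linarith
  have hl₁A : constAct S l₁ ∈ actsAbove S U c := constAct_mem_actsAbove hl₁ hcl₁
  have hl₂A : constAct S l₂ ∈ actsAbove S U c := constAct_mem_actsAbove hl₂ hcl₂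
  have hstrict : ¬ FlatPref R c (singleOut s k b) (constAct S l₁) := by
    intro h
    have := (flatPref_const_iff hR hU hc hl₂ hl₁ hcl₂ hcl₁).1
      (flatPref_trans hR hU hc hl₂A hx hl₁A h₂ h)
    rw [hul₁, hul₂] at this
    linarith
  obtain ⟨p, hp, hp'⟩ := flatPref_cont hR hU hc hl₁A hx hkA hstrict hcon
  obtain ⟨j, hj⟩ := exists_pow_lt_of_lt_one (half_pos hp.1) (one_half_lt_one (α := ℝ))
  obtain ⟨l, hl, hul, hlx⟩ := hseq j
  have hcl : expUtility U c ≤ expUtility U l := by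
    have : 0 ≤ (1 / 2 : ℝ) ^ j * (expUtility U b - expUtility U k) := by positivity
    linarith
  have hlA : constAct S l ∈ actsAbove S U c := constAct_mem_actsAbove hl hcl
  have hmA := mix_mem (convex_actsAbove U c) hl₁A hkA hp
  refine hp' (flatPref_trans hR hU hc hmA hlA hx (flatPref_mono hR hU hc hmA hlA fun z => ?_) hlx)
  rw [expUtility_mix]
  simp only [constAct]
  rw [hul, hul₁]
  have := mul_lt_mul_of_pos_right hj hd
  linarith

end

/-! ### The representation -/

section

variable [Fintype S] [Nonempty S] {R : PrefFamily S Y} (hR : SafetyAxioms R) {U : Y → ℝ}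
  (hU : ∀ k ∈ lotteries Y, ∀ l ∈ lotteries Y,
    (LotteryPref R k l ↔ expUtility U l ≤ expUtility U k))
  (hS : Fintype.card S ≠ 2)
include hR hU hS

/-- In a flat menu an act is as good as the constant act of its worst value. -/
theorem flatPref_const_worst {c : Y →₀ ℝ} (hc : c ∈ lotteries Y) {f : S → Y →₀ ℝ}
    (hf : f ∈ actsAbove S U c) {s : S} (hs : ∀ t, expUtility U (f s) ≤ expUtility U (f t)) :
    FlatPref R c f (constAct S (f s)) ∧ FlatPref R c (constAct S (f s)) f := by
  have hk : constAct S (f s) ∈ actsAbove S U c := constAct_mem_actsAbove (hf.1 s) (hf.2 s)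
  refine ⟨flatPref_mono hR hU hc hf hk hs, ?_⟩
  rcases Nat.lt_or_ge 2 (Fintype.card S) with h3 | h3
  · obtain ⟨t, hts, r, hrs, htr⟩ : ∃ t, t ≠ s ∧ ∃ r, r ≠ s ∧ t ≠ r := by
      classical
      have h4 : 1 < (Finset.univ.erase s).card := by
        rw [Finset.card_erase_of_mem (Finset.mem_univ s), Finset.card_univ]; omega
      obtain ⟨t, ht, r, hr, htr⟩ := Finset.one_lt_card.1 h4
      exact ⟨t, Finset.ne_of_mem_erase ht, r, Finset.ne_of_mem_erase hr, htr⟩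
    obtain ⟨m, hm⟩ := Finite.exists_max fun t => expUtility U (f t)
    have hx := singleOut_mem (S := S) (hf.1 s) (hf.1 m) (hf.2 s) (hf.2 m) s
    refine flatPref_trans hR hU hc hk hx hf
      (flatPref_const_singleOut hR hU hc (hf.1 s) (hf.1 m) (hf.2 s) (hs m) hts hrs htr)
      (flatPref_mono hR hU hc hx hf fun z => ?_)
    unfold singleOut
    split_ifs with h
    exacts [h ▸ le_rfl, hm z]
  · have : Subsingleton S := by
      rw [← Fintype.card_le_one_iff_subsingleton]; omega
    exact flatPref_mono hR hU hc hk hf fun t => by rw [Subsingleton.elim t s]; exact le_rfl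

theorem IsFlat.pref_iff_safetyPref {c : Y →₀ ℝ} (hc : c ∈ lotteries Y)
    {M : Set (S → Y →₀ ℝ)} (hM : IsFlat U c M) {f g : S → Y →₀ ℝ} (hf : f ∈ M) (hg : g ∈ M) :
    R M f g ↔ safetyPref S U M f g := by
  have hw : ∀ s, worstUtility U M s = expUtility U c := fun s =>
    worstUtility_eq U ⟨_, hM.const_mem, rfl⟩ fun h hh => (hM.above hh).2 s
  have hsafe : ∀ h : S → Y →₀ ℝ, ∀ s, (∀ t, expUtility U (h s) ≤ expUtility U (h t)) →
      safety U M h = expUtility U (h s) - expUtility U c := by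
    intro h s hs
    apply le_antisymm
    · exact hw s ▸ safety_le U M h s
    · rw [le_safety_iff]
      intro t
      rw [hw]
      linarith [hs t]
  have hfA := hM.above hf
  have hgA := hM.above hg
  obtain ⟨s, hs⟩ := Finite.exists_min fun t => expUtility U (f t)
  obtain ⟨t, ht⟩ := Finite.exists_min fun t => expUtility U (g t)
  have hsA : constAct S (f s) ∈ actsAbove S U c := constAct_mem_actsAbove (hfA.1 s) (hfA.2 s)
  have htA : constAct S (g t) ∈ actsAbove S U c := constAct_mem_actsAbove (hgA.1 t) (hgA.2 t)
  obtain ⟨hf1, hf2⟩ := flatPref_const_worst hR hU hS hc hfA hs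
  obtain ⟨hg1, hg2⟩ := flatPref_const_worst hR hU hS hc hgA ht
  rw [hM.pref_iff hR hU hc hf hg, safetyPref, hsafe f s hs, hsafe g t ht, sub_le_sub_iff_right,
    ← flatPref_const_iff hR hU hc (hfA.1 s) (hgA.1 t) (hfA.2 s) (hgA.2 t)]
  constructor
  · exact fun h => flatPref_trans hR hU hc hsA hgA htA
      (flatPref_trans hR hU hc hsA hfA hgA hf2 h) hg1
  · exact fun h => flatPref_trans hR hU hc hfA htA hgA
      (flatPref_trans hR hU hc hfA hsA htA hf1 h) hg2

/-- Every menu can be made flat. Let `a` be the act that yields in each state the worst lottery of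
the menu there. Mixing with the act that yields in the state `s` the average of `a` over the other
states, with weight `1 / |S|` on the menu, turns `a` into the constant act of its average, and
leaves the preferences unchanged by independence. -/
theorem SafetyAxioms.isSafetyFamily : IsSafetyFamily R U := by
  classical
  intro M hM f hf g hg
  choose w hwM hw using fun s => exists_eq_worstUtility U hM s
  set a : S → Y →₀ ℝ := fun s => w s s with ha
  have haA : a ∈ acts S Y := fun s => hM.subset_acts (hwM s) s
  have hle : ∀ h ∈ M, ∀ s, expUtility U (a s) ≤ expUtility U (h s) := fun h hh s =>
    (hw s).trans_le (worstUtility_le U hM hh s)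
  rcases subsingleton_or_nontrivial S with hsub | hnt
  · obtain ⟨s⟩ := ‹Nonempty S›
    refine IsFlat.pref_iff_safetyPref (c := a s) hR hU hS (haA s) ⟨hM, ?_, fun h hh => ?_⟩ hf hg
    · convert hwM s
      funext t
      rw [Subsingleton.elim t s]; rfl
    · exact ⟨hM.subset_acts hh, fun t => by rw [Subsingleton.elim t s]; exact hle h hh s⟩
  have hcard : (1 : ℝ) < Fintype.card S := by exact_mod_cast Fintype.one_lt_card (α := S)
  set n : ℝ := ((Fintype.card S : ℕ) : ℝ) with hn
  have hn0 : n ≠ 0 := by linarith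
  have hn1 : n - 1 ≠ 0 := by linarith
  have hp : 1 / n ∈ Ioo (0 : ℝ) 1 :=
    ⟨by positivity, (div_lt_one (by linarith)).2 hcard⟩
  set h : S → Y →₀ ℝ := fun s => ∑ t ∈ Finset.univ.erase s, (1 / (n - 1)) • a t with hh
  set c : Y →₀ ℝ := ∑ t, (1 / n) • a t with hcdef
  have hhA : h ∈ acts S Y := by
    refine fun s => convex_lotteries.sum_mem (fun _ _ => ?_) ?_ fun t _ => haA t
    · exact div_nonneg zero_le_one (by linarith)
    · rw [Finset.sum_const, Finset.card_erase_of_mem (Finset.mem_univ s), Finset.card_univ,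
        nsmul_eq_mul, Nat.cast_sub Fintype.card_pos, ← hn]
      field_simp
      simp
  have hcL : c ∈ lotteries Y := by
    refine convex_lotteries.sum_mem (fun _ _ => hp.1.le) ?_ fun t _ => haA t
    rw [Finset.sum_const, Finset.card_univ, nsmul_eq_mul, ← hn]
    field_simp
  have hmix : mix (1 / n) a h = constAct S c := by
    funext s
    rw [mix_apply, constAct, hh, hcdef, ← Finset.add_sum_erase _ _ (Finset.mem_univ s)]
    simp only [← Finset.smul_sum, smul_smul]
    congr 2
    field_simp
  have hM₂ := hM.union (finite_singleton a) (singleton_subset_iff.2 haA)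
  set M₂ := convexHull ℝ (M ∪ {a})
  have hsub : M ⊆ M₂ := subset_union_left.trans (subset_convexHull ℝ _)
  have haM₂ : a ∈ M₂ := subset_convexHull ℝ _ (Or.inr rfl)
  have hle₂ : ∀ k ∈ M₂, ∀ s, expUtility U (a s) ≤ expUtility U (k s) := by
    intro k hk s
    refine convexHull_min (union_subset (fun k hk => hle k hk s) (singleton_subset_iff.2 ?_))
      (convex_setOf_le_expUtility U s (expUtility U (a s))) hk
    exact le_refl (expUtility U (a s))
  have hflat : IsFlat U c ((fun k => mix (1 / n) k h) '' M₂) := by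
    refine ⟨hM₂.image_mix hhA hp, ⟨a, haM₂, hmix⟩, ?_⟩
    rintro _ ⟨k, hk, rfl⟩
    refine ⟨mix_mem convex_acts (hM₂.subset_acts hk) hhA hp, fun s => ?_⟩
    have h1 : expUtility U c = expUtility U (mix (1 / n) a h s) := by rw [hmix]; rfl
    simp only [h1, expUtility_mix]
    have := mul_le_mul_of_nonneg_left (hle₂ k hk s) hp.1.le
    linarith
  rw [hR.inwa M hM a haA
      (fun s => ⟨w s, hwM s, (hU _ (haA s) _ (haA s)).2 le_rfl⟩) f hf g hg,
    safetyPref_inwa U M hM a haA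
      (fun s => ⟨w s, hwM s, (lotteryPref_safetyPref U _ _).2 le_rfl⟩) f hf g hg,
    hR.independence _ hM₂ f (hsub hf) g (hsub hg) h hhA _ hp,
    safetyPref_independence U _ hM₂ f (hsub hf) g (hsub hg) h hhA _ hp]
  exact hflat.pref_iff_safetyPref hR hU hS hcL ⟨f, hsub hf, rfl⟩ ⟨g, hsub hg, rfl⟩

omit hU in
theorem SafetyAxioms.exists_utility : ∃ U : Y → ℝ, Nonconstant U ∧ IsSafetyFamily R U := by
  obtain ⟨U, hU⟩ := hR.mixtureOrder.exists_expUtility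
  refine ⟨U, ?_, hR.isSafetyFamily hU hS⟩
  by_contra hcon
  simp only [Nonconstant, not_exists, not_not] at hcon
  obtain ⟨k, hk, l, hl, hkl⟩ := hR.exists_not_lotteryPref
  rw [hU k hk l hl, not_le] at hkl
  obtain ⟨y₀⟩ : Nonempty Y := by
    by_contra hY
    rw [not_nonempty_iff] at hY
    simp [Subsingleton.elim k l] at hkl
  have hconst : ∀ x ∈ lotteries Y, expUtility U x = U y₀ := by
    intro x hx
    have h1 : ∑ y ∈ x.support, x y = 1 := hx.2
    simp only [expUtility, Finsupp.sum, fun y => hcon y y₀, ← Finset.sum_mul, h1, one_mul]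
  rw [hconst k hk, hconst l hl] at hkl
  exact lt_irrefl _ hkl

end

end MaximinSafety

theorem theorem1 (S Y : Type*) [Fintype S] [Nonempty S] :
    -- soundness
    (∀ U : Y → ℝ, MaximinSafety.Nonconstant U →
      MaximinSafety.SafetyAxioms (MaximinSafety.safetyPref S U)) ∧
    -- representation
    (Fintype.card S ≠ 2 → ∀ R : MaximinSafety.PrefFamily S Y, MaximinSafety.SafetyAxioms R →
      ∃ U : Y → ℝ, MaximinSafety.Nonconstant U ∧ MaximinSafety.IsSafetyFamily R U) ∧
    -- uniqueness
    (∀ R : MaximinSafety.PrefFamily S Y, MaximinSafety.SafetyAxioms R →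
      ∀ U : Y → ℝ, MaximinSafety.IsSafetyFamily R U →
        ∀ U' : Y → ℝ, MaximinSafety.IsSafetyFamily R U' ↔
          ∃ a b : ℝ, 0 < a ∧ ∀ y, U' y = a * U y + b) := by
  exact ⟨fun U hU => MaximinSafety.safetyPref_axioms hU, fun hS R hR => hR.exists_utility hS,
    fun R hR U hU U' => hU.iff_affine hR U'⟩
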